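/- Fix integers $r\ge 1$, $k\ge 0$ and tuples $\boldsymbol m=(m_1,\dots,m_r)$, $\boldsymbol l=(l_1,\dots,l_r)$ of non-negative integers. Put $l_0=k$, $l_{r+1}=0$. The triple $(\boldsymbol m,\boldsymbol l,k)$ is called \emph{consistent} if $k\ge l_1\ge\dots\ge l_r\ge 0$ and $l_s-l_{s+1}\le m_s$ for $s=1,\dots,r$. For $i=0,\dots,r$ put $$e_i(\boldsymbol l,k)=k+\sum_{s=1}^i m_s-l_i+l_{i+1}+i,\qquad e_i^\vee(\boldsymbol l,k)=\sum_{s=r+1-i}^r m_s-l_{r-i+1}+l_{r-i}+i .$$ For a finite-dimensional space $V\subset\mathbb C[x]$, the exponents of $V$ at $z\in\mathbb C$ (resp. at infinity) are the orders of vanishing at $z$ (resp. the degrees) of the non-zero elements of $V$; a singular point of $V$ is a root of the Wronskian of a basis of $V$. Let $V(\boldsymbol l,k)$ (resp. $U(\boldsymbol l,k)$) denote the $(r+1)$-dimensional space of polynomials without base points and without singular points outside $\{0,1\}$ such that - for $V(\boldsymbol l,k)$: the set of exponents is $\{\,i+\sum_{s=1}^i m_s : 0\le i\le r\}$ at $0$,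 $\{0,k+1,k+2,\dots,k+r\}$ at $1$, and $\{e_0(\boldsymbol l,k),\dots,e_r(\boldsymbol l,k)\}$ at infinity; - for $U(\boldsymbol l,k)$: the set of exponents is $\{\,i+\sum_{s=r+1-i}^r m_s : 0\le i\le r\}$ at $0$, $\{0,1,\dots,r-1,r+k\}$ at $1$, and $\{e^\vee_0(\boldsymbol l,k),\dots,e^\vee_r(\boldsymbol l,k)\}$ at infinity. Let $\boldsymbol 1_i=(1,\dots,1,0,\dots,0)$ ($i$ ones, $r-i$ zeros), and define $$D_i(\boldsymbol l,k)=x(x-1)\frac{d}{dx}-e_i(\boldsymbol l,k)\,(x-1)-k-1,\qquad D_i^\vee(\boldsymbol l,k)=x\frac{d}{dx}-e^\vee_{r-i}(\boldsymbol l,k)\qquad(i=0,\dots,r).$$ Let $(\boldsymbol m,\boldsymbol l,k)$ be consistent. Then: 1. The space $V(\boldsymbol l,k)$ exists and is unique, $V(\boldsymbol 0,0)=\mathrm{span}\{x^{e_i(\boldsymbol 0,0)}: 0\le i\le r\}$, where $e_i(\boldsymbol 0,0)=i+\sum_{s=1}^i m_s$, and there is a unique linear differential operator $D_{\boldsymbol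 l,k}$ of order $k$ of the form $$D_{\boldsymbol l,k}=D_{j(k)}\Big(\sum_{s=1}^{k-1}\boldsymbol 1_{j(s)},k-1\Big)\cdots D_{j(2)}(\boldsymbol 1_{j(1)},1)\,D_{j(1)}(\boldsymbol 0,0)$$ with $j(s)\in\{0,\dots,r\}$ and $\sum_{s=1}^k\boldsymbol 1_{j(s)}=\boldsymbol l$, such that $V(\boldsymbol l,k)=D_{\boldsymbol l,k}V(\boldsymbol 0,0)$. 2. The space $U(\boldsymbol l,k)$ exists and is unique, $U(\boldsymbol 0,0)=\mathrm{span}\{x^{e^\vee_i(\boldsymbol 0,0)}: 0\le i\le r\}$, where $e^\vee_i(\boldsymbol 0,0)=i+\sum_{s=r+1-i}^r m_s$, and there is a unique linear differential operator $D^\vee_{\boldsymbol l,k}$ of order $k$ of the form $$D^\vee_{\boldsymbol l,k}=D^\vee_{j(1)}(\boldsymbol 1_{j(1)},1)\,D^\vee_{j(2)}(\boldsymbol 1_{j(1)}+\boldsymbol 1_{j(2)},2)\cdots D^\vee_{j(k)}\Big(\sum_{s=1}^{k}\boldsymbol 1_{j(s)},k\Big)$$ with $j(s)\in\{0,\dots,r\}$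 and $\sum_{s=1}^k\boldsymbol 1_{j(s)}=\boldsymbol l$, such that $U(\boldsymbol 0,0)=D^\vee_{\boldsymbol l,k}U(\boldsymbol l,k)$. For $k=0$ both operators are the identity. -/

import Mathlib

open Polynomial

noncomputable section

namespace TwoPointSpaces

/-! ### Parameters

The tuples `m = (m₁, …, m_r)` and `l = (l₁, …, l_r)` are functions on `Fin r`, so that the
mathematical index `s` is the element `s - 1` of `Fin r`. -/

/-- The number `l_i` for every `i`, with the conventions `l₀ = k` and `l_i = 0` for `i > r`. -/
def ext {r : ℕ} (l : Fin r → ℕ) (k : ℕ) : ℕ → ℕ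
  | 0 => k
  | i + 1 => if h : i < r then l ⟨i, h⟩ else 0

/-- `k ≥ l₁ ≥ ⋯ ≥ l_r ≥ 0` and `l_s - l_{s+1} ≤ m_s` for `s = 1, …, r`, where `l_{r+1} = 0`. -/
def Consistent {r : ℕ} (m l : Fin r → ℕ) (k : ℕ) : Prop :=
  (∀ i : ℕ, i < r → ext l k (i + 1) ≤ ext l k i) ∧
  ∀ s : Fin r, (ext l k (s + 1) : ℤ) - (ext l k (s + 2) : ℤ) ≤ (m s : ℤ)

/-- The sum `n₁ + ⋯ + n_i` of the first `i` entries. -/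
def firstSum {r : ℕ} (n : Fin r → ℕ) (i : ℕ) : ℕ :=
  ∑ s : Fin r, if (s : ℕ) < i then n s else 0

/-- The sum `n_{i+1} + ⋯ + n_r` of the entries after the first `i`. -/
def tailSum {r : ℕ} (n : Fin r → ℕ) (i : ℕ) : ℕ :=
  ∑ s : Fin r, if i ≤ (s : ℕ) then n s else 0

/-- The vector `(1, …, 1, 0, …, 0)` of length `r` with `i` ones. -/
def ones {r : ℕ} (i : Fin (r + 1)) : Fin r → ℕ :=
  fun s => if (s : ℕ) < (i : ℕ) then 1 else 0

/-- `e_i(m,l,k) = k + ∑_{s=1}^{i} m_s - l_i + l_{i+1} + i`. -/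
def degV {r : ℕ} (m l : Fin r → ℕ) (k : ℕ) (i : Fin (r + 1)) : ℤ :=
  (k : ℤ) + (firstSum m i : ℤ) - (ext l k i : ℤ) + (ext l k (i + 1) : ℤ) + (i : ℤ)

/-- `e^∨_i(m,l,k) = ∑_{s=r+1-i}^{r} m_s - l_{r-i+1} + l_{r-i} + i`. -/
def degU {r : ℕ} (m l : Fin r → ℕ) (k : ℕ) (i : Fin (r + 1)) : ℤ :=
  (tailSum m (r - i) : ℤ) - (ext l k (r - i + 1) : ℤ) + (ext l k (r - i) : ℤ) + (i : ℤ)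

/-! ### Spaces of polynomials: singular points and exponents -/

/-- The Wronskian `det (d^i f_j / dx^i)` of a finite family of polynomials. -/
def wronskianDet {n : ℕ} (f : Fin n → ℂ[X]) : ℂ[X] :=
  Matrix.det (Matrix.of fun i j : Fin n => derivative^[(i : ℕ)] (f j))

/-- `z` is a singular point of `V`: it is a root of the Wronskian of a basis of `V`
(the Wronskians of any two bases differ by a non-zero constant factor). -/
def IsSingularPoint (V : Submodule ℂ ℂ[X]) (z : ℂ) : Prop :=
  ∃ (n : ℕ) (b : Module.Basis (Fin n) ℂ V),
    (wronskianDet fun j => ((b j : V) : ℂ[X])).IsRoot z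

/-- The orders of vanishing at `z` of the non-zero elements of `V`. -/
def exponentsAt (V : Submodule ℂ ℂ[X]) (z : ℂ) : Set ℕ :=
  {n | ∃ f ∈ V, f ≠ 0 ∧ f.rootMultiplicity z = n}

/-- The degrees of the non-zero elements of `V`. -/
def exponentsAtInfinity (V : Submodule ℂ ℂ[X]) : Set ℤ :=
  {n | ∃ f ∈ V, f ≠ 0 ∧ (f.natDegree : ℤ) = n}

/-- The set `{0, 1 + n₁, 2 + n₁ + n₂, …, r + n₁ + ⋯ + n_r}`. -/
def exponentSet {r : ℕ} (n : Fin r → ℕ) : Set ℕ :=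
  Set.range fun i : Fin (r + 1) => (i : ℕ) + firstSum n i

/-- An `(r+1)`-dimensional space of polynomials without base points and without singular points
outside `{0, 1}`, whose exponents at `0` and `1` are given by `n₀` and `n₁` and whose set of
exponents at infinity is `{d₀, …, d_r}`. -/
structure IsTwoPointSpace {r : ℕ} (n₀ n₁ : Fin r → ℕ) (d : Fin (r + 1) → ℤ)
    (V : Submodule ℂ ℂ[X]) : Prop where
  finrank_eq : Module.finrank ℂ V = r + 1
  no_base_point : ∀ z : ℂ, ∃ f ∈ V, f.eval z ≠ 0
  singular : ∀ z : ℂ, IsSingularPoint V z → z = 0 ∨ z = 1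
  exponents_zero : exponentsAt V 0 = exponentSet n₀
  exponents_one : exponentsAt V 1 = exponentSet n₁
  exponents_infinity : exponentsAtInfinity V = Set.range d

/-- The properties that characterize `V(m,l,k)`: `n(0) = m`, `n(1) = (k,0,…,0)`, and degrees
`e_i(m,l,k)`. -/
def IsSpaceV {r : ℕ} (m l : Fin r → ℕ) (k : ℕ) (V : Submodule ℂ ℂ[X]) : Prop :=
  IsTwoPointSpace m (fun s => if (s : ℕ) = 0 then k else 0) (degV m l k) V

/-- The properties that characterize `U(m,l,k)`: `n^∨(0) = (m_r,…,m₁)`, `n^∨(1) = (0,…,0,k)`,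
and degrees `e^∨_i(m,l,k)`. -/
def IsSpaceU {r : ℕ} (m l : Fin r → ℕ) (k : ℕ) (U : Submodule ℂ ℂ[X]) : Prop :=
  IsTwoPointSpace (fun s => m s.rev) (fun s => if (s : ℕ) + 1 = r then k else 0) (degU m l k) U

open Classical in
/-- The space `V(m,l,k)` (and `⊥` if there is no space with its properties). -/
def spaceV {r : ℕ} (m l : Fin r → ℕ) (k : ℕ) : Submodule ℂ ℂ[X] :=
  if h : ∃ V, IsSpaceV m l k V then h.choose else ⊥

open Classical in
/-- The space `U(m,l,k)` (and `⊥` if there is no space with its properties). -/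
def spaceU {r : ℕ} (m l : Fin r → ℕ) (k : ℕ) : Submodule ℂ ℂ[X] :=
  if h : ∃ U, IsSpaceU m l k U then h.choose else ⊥

/-! ### Differential operators

Linear differential operators with polynomial coefficients are represented by their action on
`ℂ[X]`, which determines the coefficients; multiplication in `Module.End` is composition. -/

/-- `D = a_k ∂^k + ⋯ + a_1 ∂ + a_0` with polynomial coefficients and `a_k ≠ 0`. -/
def IsDiffOpOfOrder (k : ℕ) (D : Module.End ℂ ℂ[X]) : Prop :=
  ∃ a : ℕ → ℂ[X], a k ≠ 0 ∧
    ∀ f : ℂ[X], D f = ∑ i ∈ Finset.range (k + 1), a i * derivative^[i] f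

/-- `D_i(l,k) = x(x-1) d/dx - (k + ∑_{s=1}^{i} m_s - l_i + l_{i+1} + i)(x-1) - k - 1`. -/
def opV {r : ℕ} (m l : Fin r → ℕ) (k : ℕ) (i : Fin (r + 1)) : Module.End ℂ ℂ[X] :=
  LinearMap.mulLeft ℂ (X * (X - 1)) * derivative
    - LinearMap.mulLeft ℂ
        (C ((k : ℂ) + (firstSum m i : ℂ) - (ext l k i : ℂ) + (ext l k (i + 1) : ℂ) + (i : ℂ))
          * (X - 1))
    - ((k : ℂ) + 1) • 1

/-- `D^∨_i(l,k) = x d/dx - (∑_{s=i+1}^{r} m_s - l_{i+1} + l_i + r - i)`. -/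
def opU {r : ℕ} (m l : Fin r → ℕ) (k : ℕ) (i : Fin (r + 1)) : Module.End ℂ ℂ[X] :=
  LinearMap.mulLeft ℂ X * derivative
    - ((tailSum m i : ℂ) - (ext l k (i + 1) : ℂ) + (ext l k i : ℂ) + (r : ℂ) - (i : ℂ)) • 1

/-- `D_{j(k)}(1_{j(1)} + ⋯ + 1_{j(k-1)}, k-1) ⋯ D_{j(2)}(1_{j(1)}, 1) D_{j(1)}(0, 0)`. -/
def compV {r : ℕ} (m : Fin r → ℕ) : (k : ℕ) → (Fin k → Fin (r + 1)) → Module.End ℂ ℂ[X]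
  | 0, _ => 1
  | k + 1, j =>
      opV m (∑ s : Fin k, ones (j s.castSucc)) k (j (Fin.last k))
        * compV m k (fun s => j s.castSucc)

/-- `D^∨_{j(1)}(1_{j(1)}, 1) D^∨_{j(2)}(1_{j(1)} + 1_{j(2)}, 2) ⋯
D^∨_{j(k)}(1_{j(1)} + ⋯ + 1_{j(k)}, k)`. -/
def compU {r : ℕ} (m : Fin r → ℕ) : (k : ℕ) → (Fin k → Fin (r + 1)) → Module.End ℂ ℂ[X]
  | 0, _ => 1
  | k + 1, j =>
      compU m k (fun s => j s.castSucc)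
        * opU m (∑ s : Fin (k + 1), ones (j s)) (k + 1) (j (Fin.last k))

end TwoPointSpaces

end

/-! Put `c_i = l_i - l_{i+1}` (`steps`) and `a_i = i + m_1 + ... + m_i`. The `c_i` sum to `k`, and
consistency gives the gaps `a_i + c_j < a_j` for `i < j`. A path `j(1), ..., j(k)` ends at `l`
exactly when each `i` occurs `c_i` times, so a path exists, and it remains to see that the operators
depend only on these counts.

For `V`, one step of the product turns `(x-1)^(k+1) g` into `(x-1)^(k+2) (θ - α) g` with `θ = x
d/dx`. Hence the whole product sends `(x-1) f` to `(x-1)^(k+1) P(θ) f`, where `P` has the nodes `a_i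
- s - 1`, `s < c_i` (`compV_X_sub_one_mul`). The images of the `x^{a_i}` therefore agree modulo
`(x-1)^(k+1)`; by the gaps they keep their orders at `0`; and each step `i` saves one degree in the
`i`-th image. Uniqueness of `V` is uniqueness in a simultaneous Padé problem at `1`
(`eq_zero_of_simultaneous_pade`).

For `U`, the gaps make the `r+1` blocks of exponents disjoint, with `k+r+1` exponents in all. Up to
a factor there is one polynomial with this support and a zero of order `k+r` at `1`, and `U` is
spanned by its blocks. The operator is a polynomial in `θ` that kills every monomial of a block but
the lowest (`compU_generatorsU`).

That these spans have no other singular points, and exactly the required exponents, follows by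
counting zeros of the Wronskian against its degree: the bounds already sum to the extreme value, so
all are equalities (`isTwoPointSpace_of_bounds`). The same count controls the order at `1` of
polynomials with few monomials. -/

namespace TwoPointSpaces

/-! ### Valuations read off from coefficient functionals -/

section Valuation

variable {K M Γ : Type*} [Field K] [AddCommGroup M] [Module K M] [LinearOrder Γ]

/-- `v f` is the least index at which a coefficient of `f` does not vanish. -/
structure IsLeastCoeff (c : Γ → M →ₗ[K] K) (v : M → Γ) : Prop where
  ne_zero : ∀ f, f ≠ 0 → c (v f) f ≠ 0
  eq_zero : ∀ f, f ≠ 0 → ∀ n, n < v f → c n f = 0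

/-- The values of the non-zero elements of `V`. -/
def valueSet (v : M → Γ) (V : Submodule K M) : Set Γ :=
  {n | ∃ f ∈ V, f ≠ 0 ∧ v f = n}

variable {c : Γ → M →ₗ[K] K} {v : M → Γ}

/-- In a linear relation, take the term of least value among those with non-zero coefficient: the
functional at that value sees this term alone. -/
theorem IsLeastCoeff.linearIndependent (h : IsLeastCoeff c v) {ι : Type*} {f : ι → M}
    (hf : ∀ i, f i ≠ 0) (hinj : Function.Injective fun i => v (f i)) :
    LinearIndependent K f := by
  classical
  rw [linearIndependent_iff']
  intro s g hg
  by_contra! hne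
  obtain ⟨i, his, hi⟩ := hne
  have hT : (s.filter fun i => g i ≠ 0).Nonempty := ⟨i, by simp [his, hi]⟩
  obtain ⟨j, hj, hmin⟩ := Finset.exists_min_image _ (fun i => v (f i)) hT
  rw [Finset.mem_filter] at hj
  have h0 := congrArg (c (v (f j))) hg
  rw [map_sum, map_zero, Finset.sum_eq_single j] at h0
  · rw [map_smul, smul_eq_mul, mul_eq_zero] at h0
    exact h0.elim hj.2 (h.ne_zero _ (hf j))
  · intro b hb hbj
    rw [map_smul, smul_eq_mul]
    by_cases hgb : g b = 0
    · rw [hgb, zero_mul]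
    · rw [h.eq_zero _ (hf b), mul_zero]
      refine lt_of_le_of_ne (hmin b (by simp [hb, hgb])) fun he => hbj (hinj he.symm)
  · exact fun hn => absurd hj.1 hn

/-- Elements realising distinct values are independent, so there are at most `dim V` values. The
functionals at these values are jointly injective on `V`, so there are at least as many. -/
theorem IsLeastCoeff.finite_and_ncard (h : IsLeastCoeff c v) (V : Submodule K M)
    [FiniteDimensional K V] :
    (valueSet v V).Finite ∧ (valueSet v V).ncard = Module.finrank K V := by
  choose g hgV hg0 hgv using fun e : valueSet v V => e.2
  have hli : LinearIndependent K (fun e => (⟨g e, hgV e⟩ : V)) := by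
    refine LinearIndependent.of_comp V.subtype ?_
    refine h.linearIndependent hg0 fun a b hab => ?_
    rw [Subtype.ext_iff, ← hgv a, ← hgv b]
    exact hab
  have hfin : Finite (valueSet v V) := hli.finite
  have := Fintype.ofFinite (valueSet v V)
  refine ⟨Set.toFinite _, ?_⟩
  rw [Set.ncard_eq_toFinset_card', Set.toFinset_card]
  refine le_antisymm hli.fintype_card_le_finrank ?_
  let φ : V →ₗ[K] (valueSet v V → K) := LinearMap.pi fun e => (c e.1).comp V.subtype
  have hφ : Function.Injective φ := by
    rw [← LinearMap.ker_eq_bot, LinearMap.ker_eq_bot']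
    intro f hf
    by_contra hne
    have hne' : (f : M) ≠ 0 := fun h0 => hne (Subtype.ext h0)
    exact h.ne_zero f hne' (congrFun hf ⟨v f, f, f.2, hne', rfl⟩)
  simpa using LinearMap.finrank_le_finrank_of_injective hφ

end Valuation

theorem isLeastCoeff_rootMultiplicity (z : ℂ) :
    IsLeastCoeff (fun n => (lcoeff ℂ n).comp (taylor z)) (fun f : ℂ[X] => f.rootMultiplicity z) := by
  constructor
  · intro f hf
    rw [rootMultiplicity_eq_natTrailingDegree]
    change coeff (f.comp (X + C z)) _ ≠ 0
    rw [Ne, coeff_natTrailingDegree_eq_zero]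
    exact fun h => hf ((taylor_injective z) (by simpa [taylor_apply] using h))
  · intro f hf n hn
    rw [rootMultiplicity_eq_natTrailingDegree] at hn
    exact coeff_eq_zero_of_lt_natTrailingDegree hn

/-- Reversing the order on `ℕ` turns leading coefficients into least ones, so degrees and orders of
vanishing share one argument. -/
theorem isLeastCoeff_natDegree :
    IsLeastCoeff (Γ := ℕᵒᵈ) (fun n => lcoeff ℂ (OrderDual.ofDual n))
      (fun f : ℂ[X] => OrderDual.toDual f.natDegree) := by
  constructor
  · intro f hf
    simpa using hf
  · intro f hf n hn
    exact coeff_eq_zero_of_natDegree_lt hn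

/-- The degrees of the non-zero elements of `V`, as natural numbers. -/
def degreeSet (V : Submodule ℂ ℂ[X]) : Set ℕ :=
  {n | ∃ f ∈ V, f ≠ 0 ∧ f.natDegree = n}

theorem linearIndependent_of_rootMultiplicity {ι : Type*} {f : ι → ℂ[X]} (z : ℂ)
    (hf : ∀ i, f i ≠ 0) (hinj : Function.Injective fun i => (f i).rootMultiplicity z) :
    LinearIndependent ℂ f :=
  (isLeastCoeff_rootMultiplicity z).linearIndependent hf hinj

theorem linearIndependent_of_natDegree {ι : Type*} {f : ι → ℂ[X]}
    (hf : ∀ i, f i ≠ 0) (hinj : Function.Injective fun i => (f i).natDegree) :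
    LinearIndependent ℂ f :=
  isLeastCoeff_natDegree.linearIndependent hf hinj

theorem exponentsAt_finite_and_ncard (V : Submodule ℂ ℂ[X]) [FiniteDimensional ℂ V] (z : ℂ) :
    (exponentsAt V z).Finite ∧ (exponentsAt V z).ncard = Module.finrank ℂ V :=
  (isLeastCoeff_rootMultiplicity z).finite_and_ncard V

theorem degreeSet_finite_and_ncard (V : Submodule ℂ ℂ[X]) [FiniteDimensional ℂ V] :
    (degreeSet V).Finite ∧ (degreeSet V).ncard = Module.finrank ℂ V :=
  isLeastCoeff_natDegree.finite_and_ncard V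

theorem exists_strictMono_range_eq {s : Set ℕ} {n : ℕ} (hs : s.Finite) (hn : s.ncard = n) :
    ∃ α : Fin n → ℕ, StrictMono α ∧ Set.range α = s := by
  have hc : hs.toFinset.card = n := by rw [← Set.ncard_eq_toFinset_card s hs, hn]
  refine ⟨hs.toFinset.orderEmbOfFin hc, (hs.toFinset.orderEmbOfFin hc).strictMono, ?_⟩
  rw [Finset.range_orderEmbOfFin]
  simp

theorem exists_exponentsAt (V : Submodule ℂ ℂ[X]) [FiniteDimensional ℂ V] {n : ℕ}
    (hV : Module.finrank ℂ V = n) (z : ℂ) :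
    ∃ α : Fin n → ℕ, StrictMono α ∧ Set.range α = exponentsAt V z :=
  exists_strictMono_range_eq (exponentsAt_finite_and_ncard V z).1
    ((exponentsAt_finite_and_ncard V z).2.trans hV)

theorem exists_degreeSet (V : Submodule ℂ ℂ[X]) [FiniteDimensional ℂ V] {n : ℕ}
    (hV : Module.finrank ℂ V = n) :
    ∃ α : Fin n → ℕ, StrictMono α ∧ Set.range α = degreeSet V :=
  exists_strictMono_range_eq (degreeSet_finite_and_ncard V).1
    ((degreeSet_finite_and_ncard V).2.trans hV)

/-- Injectively indexed exponents of `V`, as many as the dimension, are all of them. -/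
theorem exponentsAt_eq_range {V : Submodule ℂ ℂ[X]} [FiniteDimensional ℂ V] {n : ℕ}
    (hV : Module.finrank ℂ V = n) {z : ℂ} {α : Fin n → ℕ} (hα : Function.Injective α)
    (h : ∀ i, α i ∈ exponentsAt V z) : exponentsAt V z = Set.range α := by
  obtain ⟨hf, hc⟩ := exponentsAt_finite_and_ncard V z
  refine (Set.eq_of_subset_of_ncard_le (by rintro _ ⟨i, rfl⟩; exact h i) ?_ hf).symm
  rw [hc, hV, ← Set.image_univ, Set.ncard_image_of_injective _ hα]
  simp

theorem degreeSet_eq_range {V : Submodule ℂ ℂ[X]} [FiniteDimensional ℂ V] {n : ℕ}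
    (hV : Module.finrank ℂ V = n) {α : Fin n → ℕ} (hα : Function.Injective α)
    (h : ∀ i, α i ∈ degreeSet V) : degreeSet V = Set.range α := by
  obtain ⟨hf, hc⟩ := degreeSet_finite_and_ncard V
  refine (Set.eq_of_subset_of_ncard_le (by rintro _ ⟨i, rfl⟩; exact h i) ?_ hf).symm
  rw [hc, hV, ← Set.image_univ, Set.ncard_image_of_injective _ hα]
  simp

theorem exponentsAtInfinity_eq (V : Submodule ℂ ℂ[X]) :
    exponentsAtInfinity V = (fun n : ℕ => (n : ℤ)) '' degreeSet V := by
  ext n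
  constructor
  · rintro ⟨f, hf, h0, rfl⟩
    exact ⟨_, ⟨f, hf, h0, rfl⟩, rfl⟩
  · rintro ⟨_, ⟨f, hf, h0, rfl⟩, rfl⟩
    exact ⟨f, hf, h0, rfl⟩

/-! ### Degrees and zeros of Wronskians -/

theorem coeff_prod_of_natDegree_le' {ι : Type*} (s : Finset ι) (f : ι → ℂ[X]) (d : ι → ℕ)
    (h : ∀ i ∈ s, (f i).natDegree ≤ d i) :
    (∏ i ∈ s, f i).coeff (∑ i ∈ s, d i) = ∏ i ∈ s, (f i).coeff (d i) := by
  classical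
  induction s using Finset.induction_on with
  | empty => simp
  | insert a s ha ih =>
    rw [Finset.prod_insert ha, Finset.sum_insert ha, Finset.prod_insert ha,
      ← ih fun i hi => h i (Finset.mem_insert_of_mem hi)]
    refine coeff_mul_add_eq_of_natDegree_le (h a (Finset.mem_insert_self _ _)) ?_
    exact (natDegree_prod_le _ _).trans
      (Finset.sum_le_sum fun i hi => h i (Finset.mem_insert_of_mem hi))

theorem natDegree_det_le {n : ℕ} (A : Matrix (Fin n) (Fin n) ℂ[X]) (d : Fin n → ℕ)
    (h : ∀ i j, (A i j).natDegree ≤ d j) : A.det.natDegree ≤ ∑ j, d j := by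
  rw [Matrix.det_apply]
  refine natDegree_sum_le_of_forall_le _ _ fun σ _ => ?_
  refine (natDegree_smul_le _ _).trans ((natDegree_prod_le _ _).trans ?_)
  exact Finset.sum_le_sum fun i _ => h _ _

theorem coeff_det_of_natDegree_le {n : ℕ} (A : Matrix (Fin n) (Fin n) ℂ[X]) (d : Fin n → ℕ)
    (h : ∀ i j, (A i j).natDegree ≤ d j) :
    A.det.coeff (∑ j, d j) = (Matrix.of fun i j => (A i j).coeff (d j)).det := by
  rw [Matrix.det_apply, Matrix.det_apply, finsetSum_coeff]
  refine Finset.sum_congr rfl fun σ _ => ?_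
  rw [coeff_smul, coeff_prod_of_natDegree_le' _ _ _ fun i _ => h _ _]
  simp

theorem dvd_det_of_dvd_column {n : ℕ} (A : Matrix (Fin n) (Fin n) ℂ[X]) (p : Fin n → ℂ[X])
    (h : ∀ i j, p j ∣ A i j) : ∏ j, p j ∣ A.det := by
  choose B hB using h
  have : A = Matrix.of fun i j => p j * Matrix.of B i j := by
    ext1 i j; exact hB i j
  rw [this, Matrix.det_mul_row]
  exact dvd_mul_right _ _

/-- Scaling the `i`-th row of the Wronskian matrix by `(X - z)^i`. -/
theorem pow_mul_wronskianDet {n : ℕ} (f : Fin n → ℂ[X]) (p : ℂ[X]) :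
    p ^ (∑ i : Fin n, (i : ℕ)) * wronskianDet f =
      (Matrix.of fun i j : Fin n => p ^ (i : ℕ) * derivative^[(i : ℕ)] (f j)).det := by
  rw [wronskianDet, ← Finset.prod_pow_eq_pow_sum]
  exact (Matrix.det_mul_column _ _).symm

/-- After scaling row `i` by `X ^ i`, the degree bound for an entry of the Wronskian matrix depends
on its column only. -/
theorem natDegree_X_pow_mul_iterate_derivative_le (f : ℂ[X]) (i : ℕ) :
    (X ^ i * derivative^[i] f).natDegree ≤ f.natDegree := by
  by_cases h : derivative^[i] f = 0
  · simp [h]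
  · have h1 := natDegree_iterate_derivative f i
    have h2 : i ≤ f.natDegree := by
      by_contra! hlt
      exact h (iterate_derivative_eq_zero hlt)
    refine natDegree_mul_le.trans ?_
    rw [natDegree_X_pow]
    omega

theorem natDegree_wronskianDet_add_le {n : ℕ} {f : Fin n → ℂ[X]} (h : wronskianDet f ≠ 0) :
    (wronskianDet f).natDegree + ∑ i : Fin n, (i : ℕ) ≤ ∑ j, (f j).natDegree := by
  have h1 := natDegree_det_le
    (Matrix.of fun i j : Fin n => (X : ℂ[X]) ^ (i : ℕ) * derivative^[(i : ℕ)] (f j))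
    (fun j => (f j).natDegree) fun i j => natDegree_X_pow_mul_iterate_derivative_le _ _
  rw [← pow_mul_wronskianDet, natDegree_mul (pow_ne_zero _ X_ne_zero) h, natDegree_X_pow] at h1
  omega

/-- The top coefficient of the row-scaled determinant is the product of the leading coefficients
times a determinant of falling factorials of the degrees. The latter is a Vandermonde determinant
with distinct nodes. -/
theorem wronskianDet_ne_zero_of_natDegree {n : ℕ} {f : Fin n → ℂ[X]} (h0 : ∀ i, f i ≠ 0)
    (hinj : Function.Injective fun i => (f i).natDegree) : wronskianDet f ≠ 0 := by
  intro hW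
  have h1 := coeff_det_of_natDegree_le
    (Matrix.of fun i j : Fin n => (X : ℂ[X]) ^ (i : ℕ) * derivative^[(i : ℕ)] (f j))
    (fun j => (f j).natDegree) fun i j => natDegree_X_pow_mul_iterate_derivative_le _ _
  rw [← pow_mul_wronskianDet, hW, mul_zero, coeff_zero] at h1
  have h2 : (Matrix.of fun i j : Fin n => (Matrix.of fun i j : Fin n =>
      (X : ℂ[X]) ^ (i : ℕ) * derivative^[(i : ℕ)] (f j)) i j |>.coeff (f j).natDegree) =
      Matrix.of fun i j : Fin n => (f j).leadingCoeff *
        (Matrix.of fun a b : Fin n =>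
          eval ((fun c : Fin n => ((f c).natDegree : ℂ)) a) (descPochhammer ℂ (b : ℕ))).transpose
            i j := by
    ext i j
    simp only [Matrix.of_apply, Matrix.transpose_apply, descPochhammer_eval_eq_descFactorial]
    by_cases hij : (i : ℕ) ≤ (f j).natDegree
    · obtain ⟨e, he⟩ := Nat.exists_eq_add_of_le' hij
      have : coeff (X ^ (i : ℕ) * derivative^[(i : ℕ)] (f j)) (e + i) =
          (derivative^[(i : ℕ)] (f j)).coeff e := coeff_X_pow_mul _ _ _
      rw [leadingCoeff, he, this, coeff_iterate_derivative, nsmul_eq_mul, mul_comm]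
    · rw [Nat.descFactorial_of_lt (by omega), iterate_derivative_eq_zero (by omega)]
      simp
  rw [h2, Matrix.det_mul_row, Matrix.det_transpose,
    ← Matrix.det_eval_matrixOfPolynomials_eq_det_vandermonde _ _
      (fun i => descPochhammer_natDegree ℂ _) (fun i => monic_descPochhammer ℂ _)] at h1
  rcases mul_eq_zero.1 h1.symm with h3 | h3
  · rw [Finset.prod_eq_zero_iff] at h3
    obtain ⟨i, -, hi⟩ := h3
    exact h0 i (leadingCoeff_eq_zero.1 hi)
  · refine (Matrix.det_vandermonde_ne_zero_iff.2 fun a b hab => hinj ?_) h3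
    exact_mod_cast hab

theorem pow_dvd_pow_mul_iterate_derivative {p f : ℂ[X]} {e : ℕ} (h : p ^ e ∣ f) (i : ℕ) :
    p ^ e ∣ p ^ i * derivative^[i] f := by
  have h1 : p ^ (e - i) ∣ derivative^[i] f := pow_sub_dvd_iterate_derivative_of_pow_dvd i h
  refine (pow_dvd_pow p (show e ≤ i + (e - i) by omega)).trans ?_
  rw [pow_add]
  exact mul_dvd_mul_left _ h1

/-- With row `i` scaled by `(X - z)^i`, column `j` is divisible by `X - z` to the order of `f j`;
the scaling accounts for the last sum. -/
theorem sum_le_rootMultiplicity_wronskianDet {n : ℕ} {f : Fin n → ℂ[X]} (h : wronskianDet f ≠ 0)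
    (z : ℂ) : ∑ j, (f j).rootMultiplicity z ≤
      (wronskianDet f).rootMultiplicity z + ∑ i : Fin n, (i : ℕ) := by
  have h1 := dvd_det_of_dvd_column
    (Matrix.of fun i j : Fin n => (X - C z : ℂ[X]) ^ (i : ℕ) * derivative^[(i : ℕ)] (f j))
    (fun j => (X - C z) ^ (f j).rootMultiplicity z) fun i j =>
      pow_dvd_pow_mul_iterate_derivative (pow_rootMultiplicity_dvd _ _) _
  have hz : (X - C z : ℂ[X]) ≠ 0 := X_sub_C_ne_zero z
  have hne : (X - C z) ^ (∑ i : Fin n, (i : ℕ)) * wronskianDet f ≠ 0 :=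
    mul_ne_zero (pow_ne_zero _ hz) h
  rw [← pow_mul_wronskianDet, Finset.prod_pow_eq_pow_sum, ← le_rootMultiplicity_iff hne,
    rootMultiplicity_mul hne, rootMultiplicity_X_sub_C_pow] at h1
  omega

theorem wronskianDet_eq_of_mem_span {n : ℕ} {f g : Fin n → ℂ[X]}
    (h : ∀ j, f j ∈ Submodule.span ℂ (Set.range g)) :
    ∃ d : ℂ, wronskianDet f = C d * wronskianDet g := by
  choose P hP using fun j => (Submodule.mem_span_range_iff_exists_fun ℂ).1 (h j)
  refine ⟨(Matrix.of fun i j => P j i).det, ?_⟩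
  have : (Matrix.of fun i j : Fin n => derivative^[(i : ℕ)] (f j)) =
      (Matrix.of fun i j : Fin n => derivative^[(i : ℕ)] (g j)) *
        (Matrix.of fun i j => P j i).map (C : ℂ →+* ℂ[X]) := by
    ext1 i j
    rw [Matrix.mul_apply, Matrix.of_apply, ← hP j, iterate_derivative_sum]
    refine Finset.sum_congr rfl fun a _ => ?_
    rw [iterate_derivative_smul, Matrix.map_apply, Matrix.of_apply, Matrix.of_apply, smul_eq_C_mul,
      mul_comm]
  rw [wronskianDet, this, Matrix.det_mul, mul_comm, wronskianDet]
  congr 1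
  exact (RingHom.map_det (C : ℂ →+* ℂ[X]) _).symm

/-! ### Wronskians of bases of a space and its exponents. -/

theorem span_range_eq_of_linearIndependent {V : Submodule ℂ ℂ[X]} [FiniteDimensional ℂ V] {n : ℕ}
    (hV : Module.finrank ℂ V = n) {f : Fin n → ℂ[X]} (hf : ∀ i, f i ∈ V)
    (hli : LinearIndependent ℂ f) : Submodule.span ℂ (Set.range f) = V := by
  refine Submodule.eq_of_le_of_finrank_eq ?_ ?_
  · rw [Submodule.span_le]
    rintro _ ⟨i, rfl⟩
    exact hf i
  · rw [finrank_span_eq_card hli, hV, Fintype.card_fin]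

theorem exists_eq_C_mul_wronskianDet {V : Submodule ℂ ℂ[X]} [FiniteDimensional ℂ V] {n : ℕ}
    (hV : Module.finrank ℂ V = n) {f g : Fin n → ℂ[X]} (hf : ∀ i, f i ∈ V)
    (hli : LinearIndependent ℂ f) (hg : ∀ i, g i ∈ V) :
    ∃ d : ℂ, wronskianDet g = C d * wronskianDet f :=
  wronskianDet_eq_of_mem_span fun j => by
    rw [span_range_eq_of_linearIndependent hV hf hli]; exact hg j

theorem wronskianDet_ne_zero {V : Submodule ℂ ℂ[X]} [FiniteDimensional ℂ V] {n : ℕ}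
    (hV : Module.finrank ℂ V = n) {f : Fin n → ℂ[X]} (hf : ∀ i, f i ∈ V)
    (hli : LinearIndependent ℂ f) : wronskianDet f ≠ 0 := by
  obtain ⟨δ, hδ, hr⟩ := exists_degreeSet V hV
  have hmem : ∀ i, δ i ∈ degreeSet V := fun i => hr ▸ Set.mem_range_self i
  choose g hgV hg0 hgd using hmem
  obtain ⟨d, hd⟩ := exists_eq_C_mul_wronskianDet hV hf hli hgV
  have h1 : wronskianDet g ≠ 0 := wronskianDet_ne_zero_of_natDegree hg0 fun a b hab =>
    hδ.injective (by simpa [hgd] using hab)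
  intro h0
  rw [h0, mul_zero] at hd
  exact h1 hd

/-- The sum of the exponents at `z` is bounded by the order of the Wronskian of a basis. -/
theorem sum_exponentsAt_le {V : Submodule ℂ ℂ[X]} [FiniteDimensional ℂ V] {n : ℕ}
    (hV : Module.finrank ℂ V = n) {f : Fin n → ℂ[X]} (hf : ∀ i, f i ∈ V)
    (hli : LinearIndependent ℂ f) {z : ℂ} {α : Fin n → ℕ} (hα : Function.Injective α)
    (hmem : ∀ i, α i ∈ exponentsAt V z) :
    ∑ i, α i ≤ (wronskianDet f).rootMultiplicity z + ∑ i : Fin n, (i : ℕ) := by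
  choose g hgV hg0 hgd using hmem
  have hgli := linearIndependent_of_rootMultiplicity z hg0 fun a b hab =>
    hα (by simpa [hgd] using hab)
  have hW := wronskianDet_ne_zero hV hgV hgli
  obtain ⟨d, hd⟩ := exists_eq_C_mul_wronskianDet hV hgV hgli hf
  obtain ⟨d', hd'⟩ := exists_eq_C_mul_wronskianDet hV hf hli hgV
  have h1 := sum_le_rootMultiplicity_wronskianDet hW z
  simp only [hgd] at h1
  have h2 : (wronskianDet g).rootMultiplicity z ≤ (wronskianDet f).rootMultiplicity z :=
    rootMultiplicity_le_rootMultiplicity_of_dvd (wronskianDet_ne_zero hV hf hli)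
      ⟨C d, by rw [hd, mul_comm]⟩ z
  omega

theorem sum_rootMultiplicity_le {p : ℂ[X]} (s : Finset ℂ) :
    ∑ z ∈ s, p.rootMultiplicity z ≤ p.natDegree := by
  classical
  refine le_trans ?_ (card_roots' p)
  simp only [← count_roots]
  rw [← Multiset.sum_count_eq_card (s := s ∪ p.roots.toFinset) (m := p.roots)
    fun a ha => Finset.mem_union_right _ (Multiset.mem_toFinset.2 ha)]
  exact Finset.sum_le_sum_of_subset Finset.subset_union_left

theorem isSingularPoint_isRoot {V : Submodule ℂ ℂ[X]} [FiniteDimensional ℂ V] {n : ℕ}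
    (hV : Module.finrank ℂ V = n) {f : Fin n → ℂ[X]} (hf : ∀ i, f i ∈ V)
    (hli : LinearIndependent ℂ f) {z : ℂ} (hz : IsSingularPoint V z) :
    (wronskianDet f).IsRoot z := by
  obtain ⟨n', b, hb⟩ := hz
  obtain rfl : n' = n := by
    rw [← hV, Module.finrank_eq_card_basis b, Fintype.card_fin]
  have hbli : LinearIndependent ℂ fun j => ((b j : V) : ℂ[X]) :=
    b.linearIndependent.map' V.subtype (Submodule.ker_subtype V)
  obtain ⟨d, hd⟩ := exists_eq_C_mul_wronskianDet hV (fun j => (b j).2) hbli hf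
  rw [hd]
  exact hb.dvd (dvd_mul_left _ _)

/-! ### Vanishing at `1` of polynomials with few monomials. -/

theorem le_of_strictMono {n : ℕ} {β : Fin n → ℕ} (h : StrictMono β) (i : Fin n) : (i : ℕ) ≤ β i := by
  obtain ⟨i, hi⟩ := i
  induction i with
  | zero => exact Nat.zero_le _
  | succ i ih =>
    have h1 := ih (by omega)
    have h2 : β ⟨i, by omega⟩ < β ⟨i + 1, hi⟩ := h (by simp)
    simp only at h1 ⊢
    omega

/-- The exponents at `1` of the span of finitely many powers of `X` are `0, 1, 2, …`. -/
theorem exists_rootMultiplicity_eq (B : Finset ℕ) {n : ℕ} (hn : n < B.card) :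
    ∃ p : ℂ[X], p ≠ 0 ∧ (∀ b, b ∉ B → p.coeff b = 0) ∧ p.rootMultiplicity 1 = n := by
  classical
  obtain ⟨N, hN⟩ : ∃ N, B.card = N := ⟨_, rfl⟩
  set e := B.orderEmbOfFin hN with he
  let f : Fin N → ℂ[X] := fun i => X ^ e i
  have hli : LinearIndependent ℂ f :=
    linearIndependent_of_natDegree (fun i => pow_ne_zero _ X_ne_zero) fun a b hab => by
      simpa [f] using hab
  let V := Submodule.span ℂ (Set.range f)
  have : FiniteDimensional ℂ V := FiniteDimensional.span_of_finite ℂ (Set.finite_range f)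
  have hV : Module.finrank ℂ V = N := by rw [finrank_span_eq_card hli, Fintype.card_fin]
  have hf : ∀ i, f i ∈ V := fun i => Submodule.subset_span ⟨i, rfl⟩
  have hsupp : ∀ p ∈ V, ∀ b, b ∉ B → p.coeff b = 0 := by
    intro p hp b hb
    induction hp using Submodule.span_induction with
    | mem p hp =>
      obtain ⟨i, rfl⟩ := hp
      rw [coeff_X_pow, if_neg]
      rintro rfl
      exact hb (B.orderEmbOfFin_mem hN i)
    | zero => simp
    | add p q _ _ h1 h2 => simp [h1, h2]
    | smul c p _ h1 => simp [h1]
  obtain ⟨β, hβ, hr⟩ := exists_exponentsAt V hV 1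
  have h0 := sum_exponentsAt_le hV hf hli (z := 0) (α := fun i => e i) e.injective
    fun i => ⟨f i, hf i, pow_ne_zero _ X_ne_zero, by
      have := rootMultiplicity_X_sub_C_pow (0 : ℂ) (e i)
      simpa [f] using this⟩
  have h1 := sum_exponentsAt_le hV hf hli (z := 1) hβ.injective fun i => hr ▸ Set.mem_range_self i
  have h2 := natDegree_wronskianDet_add_le (wronskianDet_ne_zero hV hf hli)
  have h3 := sum_rootMultiplicity_le (p := wronskianDet f) {0, 1}
  rw [Finset.sum_pair zero_ne_one] at h3
  have h4 : ∑ i, (f i).natDegree = ∑ i, e i := Finset.sum_congr rfl fun i _ => by simp [f]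
  -- Adding `h0` and `h1` and bounding the total order by the degree gives `∑ e + ∑ β ≤ ∑ e + ∑ i`.
  -- Since always `β i ≥ i`, equality holds termwise.
  have h5 : ∑ i, β i = ∑ i : Fin N, (i : ℕ) :=
    le_antisymm (by omega) (Finset.sum_le_sum fun i _ => le_of_strictMono hβ i)
  have h6 := (Finset.sum_eq_sum_iff_of_le fun i _ => le_of_strictMono hβ i).1 h5.symm
  have h7 : n ∈ exponentsAt V 1 := by
    rw [← hr]
    exact ⟨⟨n, hN ▸ hn⟩, (h6 _ (Finset.mem_univ _)).symm⟩
  obtain ⟨p, hp, hp0, hpn⟩ := h7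
  exact ⟨p, hp0, hsupp p hp, hpn⟩

/-- A polynomial with `n` monomials does not vanish to order `n` at `1`. -/
theorem eq_zero_of_pow_dvd_of_support {B : Finset ℕ} {p : ℂ[X]} (h : ∀ b, b ∉ B → p.coeff b = 0)
    (hd : (X - 1) ^ B.card ∣ p) : p = 0 := by
  classical
  by_contra hp
  have h1 : B.card ≤ p.rootMultiplicity 1 := by
    rw [le_rootMultiplicity_iff hp, C_1]; exact hd
  obtain ⟨N, hN⟩ : ∃ N, B.card = N := ⟨_, rfl⟩
  -- Adjoining `p` to polynomials of orders `0, ..., N - 1` at `1` would give `N + 1` independent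
  -- polynomials supported on `N` exponents.
  choose g hg0 hgs hgd using 
    fun n : Fin N => exists_rootMultiplicity_eq B (n := n) (by omega)
  let f : Fin (N + 1) → ℂ[X] := Fin.snoc (α := fun _ => ℂ[X]) g p
  have hli : LinearIndependent ℂ f := by
    refine linearIndependent_of_rootMultiplicity 1 ?_ ?_
    · intro i
      refine Fin.lastCases ?_ (fun i => ?_) i
      · simpa [f] using hp
      · simpa [f] using hg0 i
    · intro a b
      refine Fin.lastCases ?_ (fun a => ?_) a <;> refine Fin.lastCases ?_ (fun b => ?_) b
      · simp
      · have := b.2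
        simp only [f, Fin.snoc_last, Fin.snoc_castSucc, hgd]
        intro hab
        omega
      · have := a.2
        simp only [f, Fin.snoc_last, Fin.snoc_castSucc, hgd]
        intro hab
        omega
      · simp only [f, Fin.snoc_castSucc, hgd]
        intro hab
        rw [Fin.ext hab]
  let φ : ℂ[X] →ₗ[ℂ] (B → ℂ) := LinearMap.pi fun b => lcoeff ℂ b
  have hfs : ∀ i b, b ∉ B → (f i).coeff b = 0 := by
    intro i b hb
    refine Fin.lastCases ?_ (fun i => ?_) i
    · simpa [f] using h b hb
    · simpa [f] using hgs i b hb
  have hspan : ∀ q ∈ Submodule.span ℂ (Set.range f), ∀ b, b ∉ B → q.coeff b = 0 := by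
    intro q hq b hb
    induction hq using Submodule.span_induction with
    | mem q hq =>
      obtain ⟨i, rfl⟩ := hq
      exact hfs i b hb
    | zero => simp
    | add p q _ _ h1 h2 => simp [h1, h2]
    | smul c p _ h1 => simp [h1]
  have hli2 : LinearIndependent ℂ (φ ∘ f) := by
    refine hli.map ?_
    rw [disjoint_iff, Submodule.eq_bot_iff]
    rintro q ⟨hq1, hq2⟩
    ext b
    by_cases hb : b ∈ B
    · exact congrFun (LinearMap.mem_ker.1 hq2) ⟨b, hb⟩
    · rw [hspan q hq1 b hb, coeff_zero]
  have := hli2.fintype_card_le_finrank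
  simp at this
  omega

/-- A space with prescribed exponents contains, for every `i`, an element whose order at `0` is at
least the `i`-th one and whose degree is at most the `i`-th one. -/
theorem exists_mem_of_exponents {V : Submodule ℂ ℂ[X]} {r : ℕ}
    (hV : Module.finrank ℂ V = r + 1) {α δ : Fin (r + 1) → ℕ} (hα : StrictMono α)
    (hδ : StrictMono δ) (h0 : exponentsAt V 0 = Set.range α) (hinf : degreeSet V = Set.range δ)
    (i : Fin (r + 1)) : ∃ f ∈ V, f ≠ 0 ∧ X ^ α i ∣ f ∧ f.natDegree ≤ δ i := by
  have : FiniteDimensional ℂ V := Module.finite_of_finrank_pos (by omega)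
  -- These are `r` conditions on an `(r+1)`-dimensional space. They exclude the orders `α j` with `j
  -- < i` and the degrees `δ j` with `j > i`.
  let φ : V →ₗ[ℂ] ({j : Fin (r + 1) // j ≠ i} → ℂ) := LinearMap.pi fun j =>
    (lcoeff ℂ (if j.1 < i then α j.1 else δ j.1)).comp V.subtype
  have hker : LinearMap.ker φ ≠ ⊥ := LinearMap.ker_ne_bot_of_finrank_lt (by
    rw [hV, Module.finrank_fintype_fun_eq_card, Fintype.card_subtype_compl]
    simp)
  obtain ⟨f, hf, hne⟩ := Submodule.exists_mem_ne_zero_of_ne_bot hker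
  have hf0 : (f : ℂ[X]) ≠ 0 := fun h => hne (Subtype.ext h)
  have hφ : ∀ j : Fin (r + 1), j ≠ i → coeff (f : ℂ[X]) (if j < i then α j else δ j) = 0 :=
    fun j hj => congrFun (LinearMap.mem_ker.1 hf) ⟨j, hj⟩
  refine ⟨f, f.2, hf0, ?_, ?_⟩
  · have hmem : (f : ℂ[X]).rootMultiplicity 0 ∈ exponentsAt V 0 := ⟨f, f.2, hf0, rfl⟩
    rw [h0] at hmem
    obtain ⟨j, hj⟩ := hmem
    have hji : i ≤ j := by
      by_contra! hlt
      have h1 := hφ j hlt.ne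
      rw [if_pos hlt] at h1
      simp only [hj] at h1
      have h2 := (isLeastCoeff_rootMultiplicity 0).ne_zero f hf0
      exact h2 (by simpa using h1)
    have := pow_rootMultiplicity_dvd (f : ℂ[X]) 0
    rw [C_0, sub_zero, ← hj] at this
    exact (pow_dvd_pow _ (hα.monotone hji)).trans this
  · have hmem : (f : ℂ[X]).natDegree ∈ degreeSet V := ⟨f, f.2, hf0, rfl⟩
    rw [hinf] at hmem
    obtain ⟨j, hj⟩ := hmem
    have hji : j ≤ i := by
      by_contra! hlt
      have h1 := hφ j hlt.ne'
      rw [if_neg hlt.not_gt] at h1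
      simp only [hj] at h1
      exact hf0 (leadingCoeff_eq_zero.1 h1)
    rw [← hj]
    exact hδ.monotone hji

/-! ### Recognising a two-point space by numerical bounds. -/

theorem firstSum_zero {r : ℕ} (n : Fin r → ℕ) : firstSum n 0 = 0 := by
  simp [firstSum]

theorem firstSum_mono {r : ℕ} (n : Fin r → ℕ) : Monotone (firstSum n) := by
  intro i j hij
  refine Finset.sum_le_sum fun s _ => ?_
  split_ifs <;> omega

theorem strictMono_add_firstSum {r : ℕ} (n : Fin r → ℕ) :
    StrictMono fun i : Fin (r + 1) => (i : ℕ) + firstSum n i := fun _ _ hij =>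
  add_lt_add_of_lt_of_le hij (firstSum_mono n hij.le)

/-- A space whose exponents at `0` are known and whose degrees and exponents at `1` satisfy the
extreme bounds is a two-point space. -/
theorem isTwoPointSpace_of_bounds {r : ℕ} {n₀ n₁ : Fin r → ℕ} {d : Fin (r + 1) → ℕ}
    (hd : StrictMono d) {V : Submodule ℂ ℂ[X]} (hV : Module.finrank ℂ V = r + 1)
    {f : Fin (r + 1) → ℂ[X]} (hfV : ∀ i, f i ∈ V) (hf0 : ∀ i, f i ≠ 0)
    (hord : ∀ i, (f i).rootMultiplicity 0 = i + firstSum n₀ i)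
    (hdeg : ∀ i, (f i).natDegree ≤ d i)
    (hone : ∀ β : Fin (r + 1) → ℕ, StrictMono β → Set.range β = exponentsAt V 1 →
      ∀ i : Fin (r + 1), i + firstSum n₁ i ≤ β i)
    (hsum : ∑ i, d i = ∑ i : Fin (r + 1), firstSum n₀ i +
      ∑ i : Fin (r + 1), ((i : ℕ) + firstSum n₁ i)) :
    IsTwoPointSpace n₀ n₁ (fun i => (d i : ℤ)) V := by
  have : FiniteDimensional ℂ V := Module.finite_of_finrank_pos (by omega)
  have hli : LinearIndependent ℂ f := by
    refine linearIndependent_of_rootMultiplicity 0 hf0 ?_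
    simp only [hord]
    exact (strictMono_add_firstSum n₀).injective
  obtain ⟨β, hβ, hr⟩ := exists_exponentsAt V hV 1
  have hW := wronskianDet_ne_zero hV hfV hli
  have e0 : exponentsAt V 0 = exponentSet n₀ :=
    exponentsAt_eq_range hV (strictMono_add_firstSum n₀).injective
      fun i => ⟨f i, hfV i, hf0 i, hord i⟩
  have h0 := sum_exponentsAt_le hV hfV hli (z := 0) (strictMono_add_firstSum n₀).injective
    fun i => ⟨f i, hfV i, hf0 i, hord i⟩
  have h1 := sum_exponentsAt_le hV hfV hli (z := 1) hβ.injective fun i => hr ▸ Set.mem_range_self i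
  have h2 := natDegree_wronskianDet_add_le hW
  have hle1 := hone β hβ hr
  have hs1 := Finset.sum_le_sum fun i (_ : i ∈ Finset.univ) => hle1 i
  have hs2 := Finset.sum_le_sum fun i (_ : i ∈ Finset.univ) => hdeg i
  rw [Finset.sum_add_distrib] at h0
  have h3 := sum_rootMultiplicity_le (p := wronskianDet f) {0, 1}
  rw [Finset.sum_pair zero_ne_one] at h3
  -- By `hsum` the chain formed by `h0`, `h1`, `h2`, `h3` and the two termwise bounds closes up, so
  -- every link is an equality.
  have hβ1 : ∀ i : Fin (r + 1), i + firstSum n₁ i = β i := fun i =>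
    (Finset.sum_eq_sum_iff_of_le fun i _ => hle1 i).1 (by omega) i (Finset.mem_univ _)
  have hdeg' : ∀ i, (f i).natDegree = d i := fun i =>
    (Finset.sum_eq_sum_iff_of_le fun i _ => hdeg i).1 (by omega) i (Finset.mem_univ _)
  have e1 : exponentsAt V 1 = exponentSet n₁ := by
    rw [← hr, exponentSet]
    congr 1
    exact (funext hβ1).symm
  have hsing : ∀ z, IsSingularPoint V z → z = 0 ∨ z = 1 := by
    intro z hz
    by_contra! hne
    have hroot := isSingularPoint_isRoot hV hfV hli hz
    -- The orders at `0` and `1` already exhaust the degree of the Wronskian, so no third root is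
    -- left.
    have h4 := sum_rootMultiplicity_le (p := wronskianDet f) {z, 0, 1}
    rw [Finset.sum_insert (by simp [hne.1, hne.2]), Finset.sum_pair zero_ne_one] at h4
    have h5 := (rootMultiplicity_pos hW).2 hroot
    omega
  have hbase : ∀ n : Fin r → ℕ, 0 ∈ exponentSet n := fun n => ⟨0, by simp [firstSum_zero]⟩
  refine ⟨hV, ?_, hsing, e0, e1, ?_⟩
  · intro z
    by_contra! hz
    have hno : 0 ∉ exponentsAt V z := by
      rintro ⟨p, hp, hp0, hpz⟩
      exact absurd ((rootMultiplicity_pos hp0).2 (hz p hp)) (by omega)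
    -- At a base point the row of the Wronskian matrix without derivatives vanishes.
    have hsz : IsSingularPoint V z := by
      let b := (Module.finBasisOfFinrankEq ℂ V hV)
      refine ⟨r + 1, b, ?_⟩
      rw [IsRoot, wronskianDet, ← coe_evalRingHom, RingHom.map_det]
      refine Matrix.det_eq_zero_of_row_eq_zero 0 fun j => ?_
      simpa using hz _ (b j).2
    rcases hsing z hsz with rfl | rfl
    · exact hno (e0 ▸ hbase _)
    · exact hno (e1 ▸ hbase _)
  · rw [exponentsAtInfinity_eq, degreeSet_eq_range hV hd.injective
      fun i => ⟨f i, hfV i, hf0 i, hdeg' i⟩, ← Set.range_comp]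
    rfl

/-! ### Combinatorics of consistent parameters -/

/-- The differences `l_i - l_{i+1}`, for `i = 0, …, r`. -/
def steps {r : ℕ} (l : Fin r → ℕ) (k : ℕ) (i : Fin (r + 1)) : ℕ :=
  ext l k i - ext l k (i + 1)

theorem ext_of_lt {r : ℕ} (l : Fin r → ℕ) (k : ℕ) {i : ℕ} (h : r < i) : ext l k i = 0 := by
  obtain _ | i := i
  · omega
  · simp only [ext]
    rw [dif_neg (by omega)]

theorem firstSum_succ {r : ℕ} (n : Fin r → ℕ) (i : Fin r) :
    firstSum n (i + 1) = firstSum n i + n i := by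
  have : n i = ∑ s : Fin r, if s = i then n s else 0 := by simp
  rw [this, firstSum, firstSum, ← Finset.sum_add_distrib]
  refine Finset.sum_congr rfl fun s _ => ?_
  by_cases h : s = i
  · subst h; simp
  · have : (s : ℕ) ≠ i := fun h' => h (Fin.ext h')
    simp only [h, if_false]
    split_ifs <;> omega

theorem tailSum_eq_add {r : ℕ} (n : Fin r → ℕ) (i : Fin r) :
    tailSum n i = tailSum n (i + 1) + n i := by
  have : n i = ∑ s : Fin r, if s = i then n s else 0 := by simp
  rw [this, tailSum, tailSum, ← Finset.sum_add_distrib]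
  refine Finset.sum_congr rfl fun s _ => ?_
  by_cases h : s = i
  · subst h; simp
  · have : (s : ℕ) ≠ i := fun h' => h (Fin.ext h')
    simp only [h, if_false]
    split_ifs <;> omega

theorem tailSum_anti {r : ℕ} (n : Fin r → ℕ) : Antitone (tailSum n) := by
  intro i j hij
  refine Finset.sum_le_sum fun s _ => ?_
  split_ifs <;> omega

theorem firstSum_rev {r : ℕ} (n : Fin r → ℕ) {i : ℕ} (hi : i ≤ r) :
    firstSum (fun s => n s.rev) i = tailSum n (r - i) := by
  rw [firstSum, tailSum, ← Equiv.sum_comp Fin.revPerm]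
  refine Finset.sum_congr rfl fun s _ => ?_
  simp only [Fin.revPerm_apply, Fin.rev_rev, Fin.val_rev]
  split_ifs <;> omega

namespace Consistent

variable {r : ℕ} {m l : Fin r → ℕ} {k : ℕ}

theorem ext_eq (h : Consistent m l k) (i : Fin (r + 1)) :
    ext l k i = ext l k (i + 1) + steps l k i := by
  have : ext l k (i + 1) ≤ ext l k i := by
    rcases (Nat.lt_succ_iff.1 i.2).lt_or_eq with h1 | h1
    · exact h.1 i h1
    · rw [ext_of_lt l k (by omega)]
      exact Nat.zero_le _
  rw [steps]
  omega

theorem sum_steps (h : Consistent m l k) : ∑ i, steps l k i = k := by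
  have h1 : ∀ n, n ≤ r + 1 →
      ext l k 0 = ext l k n + ∑ i ∈ Finset.range n, (ext l k i - ext l k (i + 1)) := by
    intro n
    induction n with
    | zero => simp
    | succ n ih =>
      intro hn
      have := h.ext_eq ⟨n, hn⟩
      simp only [steps] at this
      rw [Finset.sum_range_succ, ih (by omega)]
      omega
  have h2 := h1 (r + 1) le_rfl
  rw [ext_of_lt l k (Nat.lt_succ_self r), zero_add] at h2
  rw [Finset.sum_range] at h2
  exact h2.symm

theorem steps_le (h : Consistent m l k) (i : Fin (r + 1)) : steps l k i ≤ k := by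
  have := Finset.single_le_sum (f := steps l k) (fun _ _ => Nat.zero_le _) (Finset.mem_univ i)
  rwa [h.sum_steps] at this

theorem steps_succ_le (h : Consistent m l k) (i : Fin r) : steps l k i.succ ≤ m i := by
  have h1 : (ext l k (i + 1) : ℤ) - (ext l k (i + 1 + 1) : ℤ) ≤ (m i : ℤ) := h.2 i
  simp only [steps, Fin.val_succ]
  omega

/-- Only `steps` at positive indices is bounded by an entry of `m`, and an index `j > i` is
positive. This is the form in which consistency is used for `V`; `gap_rev` is its counterpart for
`U`. -/
theorem gap (h : Consistent m l k) {i j : Fin (r + 1)} (hij : i < j) :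
    (i : ℕ) + firstSum m i + steps l k j < j + firstSum m j := by
  obtain ⟨j', rfl⟩ := Fin.exists_succ_eq.2 (Fin.ne_zero_of_lt hij)
  have h1 := h.steps_succ_le j'
  have h2 := firstSum_succ m j'
  have h3 : (i : ℕ) < j' + 1 := hij
  have h4 := firstSum_mono m (Nat.lt_succ_iff.1 h3)
  rw [Fin.val_succ]
  omega

theorem gap_rev (h : Consistent m l k) {i j : Fin (r + 1)} (hij : i < j) :
    (i : ℕ) + tailSum m (r - i) + steps l k i.rev < j + tailSum m (r - j) := by
  have hij' : (i : ℕ) < j := hij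
  have hjr := j.2
  have h1 := h.steps_succ_le ⟨r - i - 1, by omega⟩
  have h2 := tailSum_eq_add m ⟨r - i - 1, by omega⟩
  have h4 := tailSum_anti m (show r - (j : ℕ) ≤ r - i - 1 by omega)
  have h5 : (⟨r - i - 1, by omega⟩ : Fin r).succ = i.rev := by
    ext; simp; omega
  rw [h5] at h1
  simp only [show r - (i : ℕ) - 1 + 1 = r - i by omega] at h2
  omega

theorem degV_eq (h : Consistent m l k) (i : Fin (r + 1)) :
    degV m l k i = ((i + firstSum m i + (k - steps l k i) : ℕ) : ℤ) := by
  have h1 := h.ext_eq i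
  have h2 := h.steps_le i
  rw [degV]
  omega

theorem degU_eq (h : Consistent m l k) (i : Fin (r + 1)) :
    degU m l k i = ((i + tailSum m (r - i) + steps l k i.rev : ℕ) : ℤ) := by
  have h1 := h.ext_eq i.rev
  have h2 : ((i.rev : Fin (r + 1)) : ℕ) = r - i := by rw [Fin.val_rev]; omega
  rw [h2] at h1
  rw [degU]
  omega

end Consistent

/-! ### Unions of blocks of consecutive integers -/

/-- The union of the intervals `[s i, s i + w i)`. -/
def blocks {ι : Type*} [Fintype ι] (s w : ι → ℕ) : Finset ℕ :=
  Finset.univ.biUnion fun i => Finset.Ico (s i) (s i + w i)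

theorem mem_blocks {ι : Type*} [Fintype ι] {s w : ι → ℕ} {b : ℕ} :
    b ∈ blocks s w ↔ ∃ i, s i ≤ b ∧ b < s i + w i := by
  simp [blocks]

theorem card_blocks {ι : Type*} [Fintype ι] {s w : ι → ℕ}
    (h : ∀ i j, i ≠ j → s i + w i ≤ s j ∨ s j + w j ≤ s i) :
    (blocks s w).card = ∑ i, w i := by
  rw [blocks, Finset.card_biUnion]
  · simp
  · intro i _ j _ hij
    refine Finset.disjoint_left.2 ?_
    intro b hb hb'
    rw [Finset.mem_Ico] at hb hb'
    have := h i j hij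
    omega

/-! ### Uniqueness in simultaneous Padé approximation -/

theorem eq_zero_of_pow_dvd_of_natDegree {p : ℂ[X]} {k : ℕ} (h : (X - 1) ^ (k + 1) ∣ p)
    (hp : p.natDegree ≤ k) : p = 0 := by
  by_contra h0
  have h1 := natDegree_le_of_dvd h h0
  rw [← C_1, natDegree_pow, natDegree_X_sub_C] at h1
  omega

/-- The coefficient of `(X - 1)^k`. -/
noncomputable def coeffAtOne (k : ℕ) : ℂ[X] →ₗ[ℂ] ℂ := (lcoeff ℂ k).comp (taylor 1)

theorem coeffAtOne_eq_zero_of_dvd {k : ℕ} {p : ℂ[X]} (h : (X - 1) ^ (k + 1) ∣ p) :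
    coeffAtOne k p = 0 := by
  by_cases h0 : p = 0
  · rw [h0, map_zero]
  · refine (isLeastCoeff_rootMultiplicity 1).eq_zero p h0 k ?_
    rw [← C_1, ← le_rootMultiplicity_iff h0] at h
    exact h

theorem coeffAtOne_eq_zero_of_natDegree {k : ℕ} {p : ℂ[X]} (h : p.natDegree < k) :
    coeffAtOne k p = 0 := by
  refine coeff_eq_zero_of_natDegree_lt ?_
  change (taylor 1 p).natDegree < k
  rwa [natDegree_taylor]

theorem coeffAtOne_eq_of_dvd_sub {k : ℕ} {p q : ℂ[X]} (h : (X - 1) ^ (k + 1) ∣ p - q) :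
    coeffAtOne k p = coeffAtOne k q := by
  rw [← sub_eq_zero, ← map_sub]
  exact coeffAtOne_eq_zero_of_dvd h

/-- A polynomial vanishing at `1` that is orthogonal to `k` monomials, with respect to the
coefficient of `(X - 1)^k`, is divisible by `(X - 1)^(k + 1)`. -/
theorem pow_dvd_of_coeffAtOne {k : ℕ} {B : Finset ℕ} (hB : B.card = k) {g : ℂ[X]}
    (h1 : X - 1 ∣ g) (h : ∀ b ∈ B, coeffAtOne k (X ^ b * g) = 0) : (X - 1) ^ (k + 1) ∣ g := by
  by_cases hg : g = 0
  · rw [hg]; exact dvd_zero _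
  rw [← C_1, ← le_rootMultiplicity_iff hg]
  by_contra! hlt
  have hpos : 1 ≤ g.rootMultiplicity 1 := by
    rw [le_rootMultiplicity_iff hg, pow_one, C_1]; exact h1
  -- A combination `p` of the monomials with the complementary order makes `p * g` vanish to order
  -- exactly `k`, contradicting orthogonality. Such a `p` exists since `g` vanishes at `1`, which
  -- makes the required order smaller than `B.card`.
  obtain ⟨p, hp0, hps, hpm⟩ := exists_rootMultiplicity_eq B
    (n := k - g.rootMultiplicity 1) (by omega)
  have hpg : p * g ≠ 0 := mul_ne_zero hp0 hg
  have hm : (p * g).rootMultiplicity 1 = k := by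
    rw [rootMultiplicity_mul hpg, hpm]; omega
  have h2 := (isLeastCoeff_rootMultiplicity 1).ne_zero _ hpg
  simp only [hm] at h2
  refine h2 ?_
  change coeffAtOne k (p * g) = 0
  have hsum : p = ∑ b ∈ B, p.coeff b • (X : ℂ[X]) ^ b := by
    rw [p.as_sum_support]
    have hsub : p.support ⊆ B := by
      intro b hb
      by_contra hbB
      exact (mem_support_iff.1 hb) (hps b hbB)
    refine (Finset.sum_subset hsub ?_).trans ?_
    · intro b _ hb
      rw [notMem_support_iff.1 hb, monomial_zero_right]
    · refine Finset.sum_congr rfl fun b _ => ?_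
      rw [← p.as_sum_support, smul_X_eq_monomial]
  rw [hsum, Finset.sum_mul, map_sum]
  refine Finset.sum_eq_zero fun b hb => ?_
  rw [smul_mul_assoc, map_smul, h b hb, smul_zero]

/-- Uniqueness for simultaneous Padé approximation at `1`. -/
theorem eq_zero_of_simultaneous_pade {r k : ℕ} {a c : Fin (r + 1) → ℕ}
    (hgap : ∀ i j, i < j → a i + c j < a j) (hc : ∑ i, c i = k) {q : Fin (r + 1) → ℂ[X]}
    (hq : ∀ i, (q i).natDegree ≤ k - c i) (h1 : ∀ i, X - 1 ∣ q i)
    (h : ∀ i j, (X - 1) ^ (k + 1) ∣ X ^ a i * q i - X ^ a j * q j) (i : Fin (r + 1)) :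
    q i = 0 := by
  have hck : ∀ i, c i ≤ k := fun i => by
    rw [← hc]
    exact Finset.single_le_sum (f := c) (fun _ _ => Nat.zero_le _) (Finset.mem_univ i)
  obtain ⟨N, hN⟩ : ∃ N, ∀ i, a i ≤ N :=
    ⟨∑ i, a i, fun i => Finset.single_le_sum (f := a) (fun _ _ => Nat.zero_le _)
      (Finset.mem_univ i)⟩
  have hcop : ∀ n, IsCoprime ((X : ℂ[X]) ^ n) ((X - 1) ^ (k + 1)) := fun n =>
    IsCoprime.pow ⟨1, -1, by ring⟩
  obtain ⟨u, w, huw⟩ := hcop N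
  -- Modulo `(X - 1)^(k + 1)`, `u` inverts `X ^ N`, so every `q i` is congruent to `X ^ (N - a i) *
  -- g`.
  set g := u * (X ^ a 0 * q 0) with hg
  have hgq : ∀ i, (X - 1) ^ (k + 1) ∣ X ^ (N - a i) * g - q i := by
    intro i
    refine (hcop (a i)).symm.dvd_of_dvd_mul_left ?_
    have e : X ^ a i * (X ^ (N - a i) * g - q i) =
        (X ^ a 0 * q 0 - X ^ a i * q i) - (X - 1) ^ (k + 1) * (w * (X ^ a 0 * q 0)) := by
      have hp : (X : ℂ[X]) ^ a i * X ^ (N - a i) = X ^ N := by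
        rw [← pow_add, Nat.add_sub_cancel' (hN i)]
      rw [mul_sub, ← mul_assoc, hp, hg]
      linear_combination (X ^ a 0 * q 0) * huw
    rw [e]
    exact dvd_sub (h 0 i) (dvd_mul_right _ _)
  have hcard : (blocks (fun i => N - a i) c).card = k := by
    rw [card_blocks, hc]
    intro i j hij
    have hi := hN i
    have hj := hN j
    rcases hij.lt_or_gt with h2 | h2 <;> have := hgap _ _ h2 <;> omega
  have hg1 : X - 1 ∣ g := ((h1 0).mul_left _).mul_left _
  -- The gaps make the `k` exponents `N - a i + s`, `s < c i`, distinct. Orthogonality at such an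
  -- exponent holds because the product is congruent to `X ^ s * q i`, of degree below `k`.
  have hgd := pow_dvd_of_coeffAtOne hcard hg1 (by
    intro b hb
    obtain ⟨i, hi1, hi2⟩ := mem_blocks.1 hb
    obtain ⟨s, rfl⟩ := Nat.exists_eq_add_of_le' hi1
    rw [coeffAtOne_eq_of_dvd_sub (q := X ^ s * q i)]
    · refine coeffAtOne_eq_zero_of_natDegree ?_
      refine lt_of_le_of_lt natDegree_mul_le ?_
      rw [natDegree_X_pow]
      have := hq i
      have := hck i
      omega
    · rw [pow_add X, mul_assoc, ← mul_sub]
      exact (hgq i).mul_left _)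
  refine eq_zero_of_pow_dvd_of_natDegree (k := k) ?_ ((hq i).trans (Nat.sub_le _ _))
  have := dvd_sub (hgd.mul_left (X ^ (N - a i))) (hgq i)
  rwa [sub_sub_cancel] at this

theorem rootMultiplicity_zero_eq {p : ℂ[X]} {a : ℕ} (h : X ^ a ∣ p) (ha : p.coeff a ≠ 0) :
    p.rootMultiplicity 0 = a := by
  have hp : p ≠ 0 := by rintro rfl; simp at ha
  refine le_antisymm ?_ ?_
  · by_contra! hlt
    have h1 := (le_rootMultiplicity_iff hp).1 (Nat.succ_le_of_lt hlt)
    rw [C_0, sub_zero, X_pow_dvd_iff] at h1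
    exact ha (h1 a (Nat.lt_succ_self a))
  · rw [le_rootMultiplicity_iff hp, C_0, sub_zero]
    exact h

theorem finrank_span_range {n : ℕ} {f : Fin n → ℂ[X]} (h : LinearIndependent ℂ f) :
    Module.finrank ℂ (Submodule.span ℂ (Set.range f)) = n := by
  rw [finrank_span_eq_card h, Fintype.card_fin]

theorem degreeSet_eq_of_exponentsAtInfinity {V : Submodule ℂ ℂ[X]} {r : ℕ} {d : Fin (r + 1) → ℕ}
    (h : exponentsAtInfinity V = Set.range fun i => (d i : ℤ)) :
    degreeSet V = Set.range d := by
  rw [exponentsAtInfinity_eq] at h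
  refine (Set.image_injective.2 Nat.cast_injective) (h.trans ?_)
  rw [← Set.range_comp]
  rfl

/-! ### The spaces `V` -/

theorem firstSum_head {r : ℕ} (k : ℕ) (i : Fin (r + 1)) :
    firstSum (fun s : Fin r => if (s : ℕ) = 0 then k else 0) i = if i = 0 then 0 else k := by
  by_cases h : i = 0
  · subst h
    simp [firstSum_zero]
  · have hpos : 0 < (i : ℕ) := Nat.pos_of_ne_zero fun h' => h (Fin.ext h')
    have hr : 0 < r := by have := i.2; omega
    rw [if_neg h, firstSum, Finset.sum_eq_single ⟨0, hr⟩]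
    · simp [hpos]
    · intro b _ hb
      have : (b : ℕ) ≠ 0 := fun h' => hb (Fin.ext h')
      simp [this]
    · simp

theorem natDegree_le_of_X_pow_mul {a d : ℕ} {q : ℂ[X]} (h : (X ^ a * q).natDegree ≤ a + d) :
    q.natDegree ≤ d := by
  by_cases hq : q = 0
  · simp [hq]
  · rw [natDegree_mul (pow_ne_zero _ X_ne_zero) hq, natDegree_X_pow] at h
    omega

/-- Generators of `V(l, k)`: polynomials with the prescribed orders at `0`, the prescribed bounds
on the degrees, and equal, non-vanishing Taylor expansions up to order `k` at `1`. -/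
structure IsGeneratorsV {r : ℕ} (m l : Fin r → ℕ) (k : ℕ) (F : Fin (r + 1) → ℂ[X]) : Prop where
  X_pow_dvd : ∀ i : Fin (r + 1), X ^ ((i : ℕ) + firstSum m i) ∣ F i
  coeff_ne_zero : ∀ i : Fin (r + 1), (F i).coeff (i + firstSum m i) ≠ 0
  natDegree_le : ∀ i : Fin (r + 1), (F i).natDegree ≤ i + firstSum m i + (k - steps l k i)
  dvd_sub : ∀ i j, (X - 1) ^ (k + 1) ∣ F i - F j
  eval_one : ∀ i, (F i).eval 1 ≠ 0

theorem Consistent.strictMono_degV {r : ℕ} {m l : Fin r → ℕ} {k : ℕ} (h : Consistent m l k) :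
    StrictMono fun i : Fin (r + 1) => (i : ℕ) + firstSum m i + (k - steps l k i) := by
  intro i j hij
  have h1 := h.gap hij
  have h2 := h.steps_le i
  have h3 := h.steps_le j
  simp only
  omega

theorem eval_one_eq_of_dvd_sub {k : ℕ} {p q : ℂ[X]} (h : (X - 1) ^ (k + 1) ∣ p - q) :
    p.eval 1 = q.eval 1 := by
  have h1 := (dvd_pow_self (X - 1 : ℂ[X]) (Nat.succ_ne_zero k)).trans h
  rw [← C_1, dvd_iff_isRoot, IsRoot, eval_sub] at h1
  exact sub_eq_zero.1 h1

theorem X_sub_one_dvd {p : ℂ[X]} (h : p.eval 1 = 0) : X - 1 ∣ p := by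
  rw [← C_1, dvd_iff_isRoot]
  exact h

namespace IsGeneratorsV

variable {r : ℕ} {m l : Fin r → ℕ} {k : ℕ} {F : Fin (r + 1) → ℂ[X]}

theorem ne_zero (hF : IsGeneratorsV m l k F) (i : Fin (r + 1)) : F i ≠ 0 := fun h =>
  hF.coeff_ne_zero i (by rw [h, coeff_zero])

theorem linearIndependent (hF : IsGeneratorsV m l k F) : LinearIndependent ℂ F := by
  refine linearIndependent_of_rootMultiplicity 0 hF.ne_zero ?_
  simp only [fun i : Fin (r + 1) => rootMultiplicity_zero_eq (hF.X_pow_dvd i) (hF.coeff_ne_zero i)]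
  exact (strictMono_add_firstSum m).injective

/-- Modulo `(X - 1)^(k + 1)` the span is the line through `F 0`, and `F 0` does not vanish at `1`.
-/
theorem pow_dvd_of_mem_span (hF : IsGeneratorsV m l k F) {f : ℂ[X]}
    (hf : f ∈ Submodule.span ℂ (Set.range F)) (h1 : f.eval 1 = 0) : (X - 1) ^ (k + 1) ∣ f := by
  have key : ∃ t : ℂ, (X - 1) ^ (k + 1) ∣ f - C t * F 0 := by
    clear h1
    induction hf using Submodule.span_induction with
    | mem f hf =>
      obtain ⟨i, rfl⟩ := hf
      exact ⟨1, by simpa using hF.dvd_sub i 0⟩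
    | zero => exact ⟨0, by simp⟩
    | add f g _ _ h1 h2 =>
      obtain ⟨s, hs⟩ := h1
      obtain ⟨t, ht⟩ := h2
      refine ⟨s + t, ?_⟩
      have := dvd_add hs ht
      rwa [show f - C s * F 0 + (g - C t * F 0) = f + g - C (s + t) * F 0 by
        rw [C_add]; ring] at this
    | smul c f _ h1 =>
      obtain ⟨s, hs⟩ := h1
      refine ⟨c * s, ?_⟩
      have := hs.mul_left (C c)
      rwa [show C c * (f - C s * F 0) = c • f - C (c * s) * F 0 by
        rw [C_mul, smul_eq_C_mul]; ring] at this
  obtain ⟨t, ht⟩ := key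
  have h2 := eval_one_eq_of_dvd_sub ht
  rw [h1, eval_mul, eval_C] at h2
  have h3 : t = 0 := (mul_eq_zero.1 h2.symm).resolve_right (hF.eval_one 0)
  simpa [h3] using ht

theorem isSpaceV (h : Consistent m l k) (hF : IsGeneratorsV m l k F) :
    IsSpaceV m l k (Submodule.span ℂ (Set.range F)) := by
  rw [IsSpaceV, show degV m l k = _ from funext h.degV_eq]
  refine isTwoPointSpace_of_bounds h.strictMono_degV (finrank_span_range hF.linearIndependent)
    (fun i => Submodule.subset_span ⟨i, rfl⟩) hF.ne_zero
    (fun i : Fin (r + 1) => rootMultiplicity_zero_eq (hF.X_pow_dvd i) (hF.coeff_ne_zero i)) hF.natDegree_le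
    ?_ ?_
  · intro β hβ hr i
    rw [firstSum_head]
    split_ifs with hi
    · subst hi; simp
    have hpos : (0 : Fin (r + 1)) < i := Fin.pos_iff_ne_zero.2 hi
    have h1 : ∀ j, 0 < j → k + 1 ≤ β j := by
      intro j hj
      have hlt : 0 < β j := lt_of_le_of_lt (Nat.zero_le _) (hβ hj)
      have hmem : β j ∈ exponentsAt (Submodule.span ℂ (Set.range F)) 1 :=
        hr ▸ Set.mem_range_self j
      obtain ⟨f, hf, hf0, hfj⟩ := hmem
      have hroot : f.eval 1 = 0 := (rootMultiplicity_pos hf0).1 (hfj ▸ hlt)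
      have := hF.pow_dvd_of_mem_span hf hroot
      rwa [← C_1, ← le_rootMultiplicity_iff hf0, hfj] at this
    obtain ⟨i, hir⟩ := i
    induction i with
    | zero => simp at hi
    | succ i ih =>
      by_cases hi0 : i = 0
      · subst hi0
        have := h1 ⟨1, hir⟩ hpos
        change 0 + 1 + k ≤ β ⟨1, hir⟩
        omega
      · have h2 := ih (by omega) (by simpa using hi0) (Nat.pos_of_ne_zero hi0)
        have h3 : β ⟨i, by omega⟩ < β ⟨i + 1, hir⟩ := hβ (by simp)
        simp only at h2 ⊢
        omega
  · simp only [firstSum_head]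
    have h1 : ∑ i : Fin (r + 1), ((i : ℕ) + firstSum m i + (k - steps l k i)) + k =
        ∑ i : Fin (r + 1), ((i : ℕ) + firstSum m i + k) := by
      conv_lhs => rw [← h.sum_steps]
      rw [← Finset.sum_add_distrib]
      refine Finset.sum_congr rfl fun i _ => ?_
      have := h.steps_le i
      rw [h.sum_steps]
      omega
    have h2 : ∑ i : Fin (r + 1), ((i : ℕ) + if i = 0 then 0 else k) + k =
        ∑ i : Fin (r + 1), ((i : ℕ) + k) := by
      rw [Fin.sum_univ_succ, Fin.sum_univ_succ (fun i : Fin (r + 1) => (i : ℕ) + k)]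
      simp [Fin.succ_ne_zero]
      omega
    simp only [Finset.sum_add_distrib] at h1 h2 ⊢
    omega

/-- Pick elements of `V` with the same order and degree bounds as the generators and scale both
families to the value `1` at `1`. The differences of their cofactors of `X ^ a_i` solve the
homogeneous Padé problem, hence vanish. -/
theorem eq_span (h : Consistent m l k) (hF : IsGeneratorsV m l k F) {V : Submodule ℂ ℂ[X]}
    (hV : IsSpaceV m l k V) : V = Submodule.span ℂ (Set.range F) := by
  have hdim : Module.finrank ℂ V = r + 1 := hV.finrank_eq
  have : FiniteDimensional ℂ V := Module.finite_of_finrank_pos (by omega)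
  refine (span_range_eq_of_linearIndependent hdim ?_ hF.linearIndependent).symm
  have hdiv : ∀ p ∈ V, p.eval 1 = 0 → (X - 1) ^ (k + 1) ∣ p := by
    intro p hp hp1
    by_cases hp0 : p = 0
    · rw [hp0]; exact dvd_zero _
    have hmem : p.rootMultiplicity 1 ∈ exponentsAt V 1 := ⟨p, hp, hp0, rfl⟩
    rw [hV.exponents_one] at hmem
    obtain ⟨j, hj⟩ := hmem
    simp only [firstSum_head] at hj
    have hpos := (rootMultiplicity_pos hp0).2 hp1
    rw [← C_1, ← le_rootMultiplicity_iff hp0]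
    split_ifs at hj with hj0
    · subst hj0
      simp at hj
      omega
    · have : (j : ℕ) ≠ 0 := fun h' => hj0 (Fin.ext h')
      omega
  have hinf : degreeSet V = _ := degreeSet_eq_of_exponentsAtInfinity
    (hV.exponents_infinity.trans (by rw [show degV m l k = _ from funext h.degV_eq]))
  choose f hfV hf0 hfd hfdeg using exists_mem_of_exponents hdim (strictMono_add_firstSum m)
    h.strictMono_degV hV.exponents_zero hinf
  choose q hq using hfd
  choose Q hQ using hF.X_pow_dvd
  have hqd : ∀ i : Fin (r + 1), (q i).natDegree ≤ k - steps l k i := fun i =>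
    natDegree_le_of_X_pow_mul (hq i ▸ hfdeg i)
  have hQd : ∀ i : Fin (r + 1), (Q i).natDegree ≤ k - steps l k i := fun i =>
    natDegree_le_of_X_pow_mul (hQ i ▸ hF.natDegree_le i)
  -- Otherwise `(X - 1)^(k + 1)` would divide the cofactor `q i`, whose degree is at most `k`.
  have hf1 : ∀ i, (f i).eval 1 ≠ 0 := by
    intro i hi
    have h1 := hdiv _ (hfV i) hi
    rw [hq i] at h1
    have hcop : IsCoprime ((X - 1 : ℂ[X]) ^ (k + 1)) (X ^ ((i : ℕ) + firstSum m i)) :=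
      IsCoprime.pow ⟨-1, 1, by ring⟩
    have h2 := eq_zero_of_pow_dvd_of_natDegree (hcop.dvd_of_dvd_mul_left h1)
      ((hqd i).trans (Nat.sub_le _ _))
    exact hf0 i (by rw [hq i, h2, mul_zero])
  have hqe : ∀ i, (q i).eval 1 = (f i).eval 1 := fun i => by rw [hq i]; simp
  have hQe : ∀ i, (Q i).eval 1 = (F i).eval 1 := fun i => by rw [hQ i]; simp
  have hzero := eq_zero_of_simultaneous_pade (a := fun i => (i : ℕ) + firstSum m i)
    (c := steps l k) (k := k) (fun i j hij => h.gap hij) h.sum_steps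
    (q := fun i => C ((f i).eval 1)⁻¹ * q i - C ((F i).eval 1)⁻¹ * Q i) (fun i => ?_) (fun i => ?_)
    (fun i j => ?_)
  · intro i
    have h1 := hzero i
    have h2 : F i = ((F i).eval 1 * ((f i).eval 1)⁻¹) • f i := by
      have h3 : C ((F i).eval 1) * C ((F i).eval 1)⁻¹ = (1 : ℂ[X]) := by
        rw [← C_mul, mul_inv_cancel₀ (hF.eval_one i), C_1]
      rw [smul_eq_C_mul, C_mul]
      linear_combination hQ i - C ((F i).eval 1) * C ((f i).eval 1)⁻¹ * hq i + (-C ((F i).eval 1) * X ^ ((i : ℕ) + firstSum m i)) * h1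
        - X ^ ((i : ℕ) + firstSum m i) * Q i * h3
    rw [h2]
    exact V.smul_mem _ (hfV i)
  · refine (natDegree_sub_le _ _).trans (max_le ?_ ?_)
    · exact (natDegree_C_mul_le _ _).trans (hqd i)
    · exact (natDegree_C_mul_le _ _).trans (hQd i)
  · refine X_sub_one_dvd ?_
    rw [eval_sub, eval_mul, eval_mul, eval_C, eval_C, hqe, hQe, inv_mul_cancel₀ (hf1 i),
      inv_mul_cancel₀ (hF.eval_one i), sub_self]
  · have h1 : (X - 1) ^ (k + 1) ∣ C ((f i).eval 1)⁻¹ * f i - C ((f j).eval 1)⁻¹ * f j := by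
      refine hdiv _ ?_ ?_
      · rw [← smul_eq_C_mul, ← smul_eq_C_mul]
        exact V.sub_mem (V.smul_mem _ (hfV i)) (V.smul_mem _ (hfV j))
      · rw [eval_sub, eval_mul, eval_mul, eval_C, eval_C, inv_mul_cancel₀ (hf1 i),
          inv_mul_cancel₀ (hf1 j), sub_self]
    have h2 : (X - 1) ^ (k + 1) ∣ C ((F i).eval 1)⁻¹ * F i - C ((F j).eval 1)⁻¹ * F j := by
      rw [eval_one_eq_of_dvd_sub (hF.dvd_sub i j), ← mul_sub]
      exact (hF.dvd_sub i j).mul_left _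
    have h3 := _root_.dvd_sub h1 h2
    have e : C ((f i).eval 1)⁻¹ * f i - C ((f j).eval 1)⁻¹ * f j -
        (C ((F i).eval 1)⁻¹ * F i - C ((F j).eval 1)⁻¹ * F j) =
        X ^ ((i : ℕ) + firstSum m i) * (C ((f i).eval 1)⁻¹ * q i - C ((F i).eval 1)⁻¹ * Q i) -
        X ^ ((j : ℕ) + firstSum m j) * (C ((f j).eval 1)⁻¹ * q j - C ((F j).eval 1)⁻¹ * Q j) := by
      linear_combination C ((f i).eval 1)⁻¹ * hq i - C ((f j).eval 1)⁻¹ * hq j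
        - C ((F i).eval 1)⁻¹ * hQ i + C ((F j).eval 1)⁻¹ * hQ j
    rwa [e] at h3

end IsGeneratorsV

/-! ### The spaces `U` -/

/-- A polynomial supported in `B` with the maximal order of vanishing at `1`. -/
structure IsExtremal (B : Finset ℕ) (u : ℂ[X]) : Prop where
  ne_zero : u ≠ 0
  coeff_eq_zero : ∀ b, b ∉ B → u.coeff b = 0
  dvd : (X - 1) ^ (B.card - 1) ∣ u

theorem exists_isExtremal {B : Finset ℕ} (hB : B.Nonempty) : ∃ u, IsExtremal B u := by
  obtain ⟨u, h0, hs, hm⟩ := exists_rootMultiplicity_eq B (n := B.card - 1)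
    (Nat.sub_lt hB.card_pos one_pos)
  refine ⟨u, h0, hs, ?_⟩
  rw [← C_1, ← le_rootMultiplicity_iff h0, hm]

namespace IsExtremal

variable {B : Finset ℕ} {u v : ℂ[X]}

/-- If one coefficient vanished, `B.card - 1` monomials would carry a zero of order `B.card - 1` at
`1`. -/
theorem coeff_ne_zero (hu : IsExtremal B u) {b : ℕ} (hb : b ∈ B) : u.coeff b ≠ 0 := by
  intro h
  refine hu.ne_zero (eq_zero_of_pow_dvd_of_support (B := B.erase b) ?_ ?_)
  · intro b' hb'
    by_cases h' : b' = b
    · rw [h', h]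
    · exact hu.coeff_eq_zero b' fun hb'' => hb' (Finset.mem_erase.2 ⟨h', hb''⟩)
  · rw [Finset.card_erase_of_mem hb]
    exact hu.dvd

theorem rootMultiplicity_eq (hu : IsExtremal B u) (hB : B.Nonempty) :
    u.rootMultiplicity 1 = B.card - 1 := by
  refine le_antisymm ?_ ?_
  · by_contra! hlt
    have := (le_rootMultiplicity_iff hu.ne_zero).1 hlt
    rw [C_1, Nat.succ_eq_add_one, Nat.sub_add_cancel hB.card_pos] at this
    exact hu.ne_zero (eq_zero_of_pow_dvd_of_support hu.coeff_eq_zero this)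
  · rw [le_rootMultiplicity_iff hu.ne_zero, C_1]
    exact hu.dvd

theorem exists_eq_smul (hu : IsExtremal B u) (hv : IsExtremal B v) (hB : B.Nonempty) :
    ∃ t : ℂ, t ≠ 0 ∧ u = t • v := by
  obtain ⟨b, hb⟩ := hB
  have hub := hu.coeff_ne_zero hb
  have hvb := hv.coeff_ne_zero hb
  refine ⟨u.coeff b / v.coeff b, div_ne_zero hub hvb, ?_⟩
  by_contra hne
  refine (IsExtremal.mk (B := B) (u := u - (u.coeff b / v.coeff b) • v) (sub_ne_zero.2 hne)
    ?_ ?_).coeff_ne_zero hb ?_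
  · intro b' hb'
    rw [coeff_sub, coeff_smul, hu.coeff_eq_zero b' hb', hv.coeff_eq_zero b' hb', smul_zero, sub_zero]
  · rw [smul_eq_C_mul]
    exact dvd_sub hu.dvd (hv.dvd.mul_left _)
  · rw [coeff_sub, coeff_smul, smul_eq_mul, div_mul_cancel₀ _ hvb, sub_self]

end IsExtremal

/-- The part of a polynomial with exponents in `[s, s + w)`. -/
noncomputable def blockPart (s w : ℕ) : ℂ[X] →ₗ[ℂ] ℂ[X] :=
  ∑ b ∈ Finset.Ico s (s + w), (monomial b).comp (lcoeff ℂ b)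

theorem blockPart_apply (s w : ℕ) (p : ℂ[X]) :
    blockPart s w p = ∑ b ∈ Finset.Ico s (s + w), monomial b (p.coeff b) := by
  simp [blockPart, LinearMap.sum_apply]

theorem coeff_blockPart (s w : ℕ) (p : ℂ[X]) (b : ℕ) :
    (blockPart s w p).coeff b = if s ≤ b ∧ b < s + w then p.coeff b else 0 := by
  rw [blockPart_apply, finsetSum_coeff]
  simp only [coeff_monomial]
  rw [Finset.sum_ite_eq' (Finset.Ico s (s + w)) b fun b' => p.coeff b']
  simp

theorem natDegree_blockPart_le (s w : ℕ) (p : ℂ[X]) :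
    (blockPart s (w + 1) p).natDegree ≤ s + w := by
  rw [natDegree_le_iff_coeff_eq_zero]
  intro n hn
  rw [coeff_blockPart, if_neg (by omega)]

theorem X_pow_dvd_blockPart (s w : ℕ) (p : ℂ[X]) : X ^ s ∣ blockPart s w p := by
  rw [X_pow_dvd_iff]
  intro n hn
  rw [coeff_blockPart, if_neg (by omega)]

theorem eq_sum_blockPart {n : ℕ} {s w : Fin n → ℕ}
    (hdisj : ∀ i j, i ≠ j → s i + w i ≤ s j ∨ s j + w j ≤ s i) {p : ℂ[X]}
    (hp : ∀ b, b ∉ blocks s w → p.coeff b = 0) : p = ∑ i, blockPart (s i) (w i) p := by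
  ext b
  rw [finsetSum_coeff]
  simp only [coeff_blockPart]
  by_cases hb : b ∈ blocks s w
  · obtain ⟨i, hi⟩ := mem_blocks.1 hb
    rw [Finset.sum_eq_single i]
    · rw [if_pos hi]
    · intro j _ hj
      rw [if_neg]
      have := hdisj i j hj.symm
      omega
    · simp
  · rw [hp b hb, Finset.sum_eq_zero]
    intro i _
    rw [if_neg fun h => hb (mem_blocks.2 ⟨i, h⟩)]

/-- For `r = 0` the tuple is empty and the sum is `0` rather than `k`; this is where `1 ≤ r` enters.
-/
theorem firstSum_last {r : ℕ} (hr : 1 ≤ r) (k : ℕ) (i : Fin (r + 1)) :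
    firstSum (fun s : Fin r => if (s : ℕ) + 1 = r then k else 0) i =
      if i = Fin.last r then k else 0 := by
  rw [firstSum, Finset.sum_eq_single ⟨r - 1, by omega⟩]
  · have hi := i.2
    by_cases h : i = Fin.last r
    · subst h
      rw [if_pos, if_pos, if_pos rfl]
      · simp only; omega
      · simp only [Fin.val_last]; omega
    · have : (i : ℕ) ≠ r := fun h' => h (Fin.ext h')
      rw [if_neg, if_neg h]
      simp only
      omega
  · intro b _ hb
    have : (b : ℕ) + 1 ≠ r := fun h' => hb (Fin.ext (by simp only; omega))
    simp [this]
  · simp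

section U

variable {r : ℕ} {m l : Fin r → ℕ} {k : ℕ}

/-- The lowest exponent of the `i`-th block of a space `U`. -/
def baseU (m : Fin r → ℕ) (i : Fin (r + 1)) : ℕ := i + tailSum m (r - i)

/-- The length of the `i`-th block of a space `U`. -/
def widthU (l : Fin r → ℕ) (k : ℕ) (i : Fin (r + 1)) : ℕ := steps l k i.rev + 1

/-- The exponents of the monomials that occur in the elements of `U(l, k)`. -/
def supportU (m l : Fin r → ℕ) (k : ℕ) : Finset ℕ := blocks (baseU m) (widthU l k)

theorem Consistent.disjoint_U (h : Consistent m l k) (i j : Fin (r + 1)) (hij : i ≠ j) :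
    baseU m i + widthU l k i ≤ baseU m j ∨ baseU m j + widthU l k j ≤ baseU m i := by
  rcases hij.lt_or_gt with h1 | h1
  · left; have := h.gap_rev h1; simp only [baseU, widthU]; omega
  · right; have := h.gap_rev h1; simp only [baseU, widthU]; omega

theorem Consistent.sum_steps_rev (h : Consistent m l k) : ∑ i : Fin (r + 1), steps l k i.rev = k :=
  (Equiv.sum_comp Fin.revPerm (steps l k)).trans h.sum_steps

theorem Consistent.card_supportU (h : Consistent m l k) : (supportU m l k).card = k + r + 1 := by
  rw [supportU, card_blocks h.disjoint_U]
  simp only [widthU, Finset.sum_add_distrib, h.sum_steps_rev]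
  simp
  omega

theorem Consistent.supportU_nonempty (h : Consistent m l k) : (supportU m l k).Nonempty := by
  rw [← Finset.card_pos, h.card_supportU]
  omega

theorem baseU_mem (i : Fin (r + 1)) : baseU m i ∈ supportU m l k :=
  mem_blocks.2 ⟨i, le_rfl, by simp [widthU]⟩

theorem Consistent.strictMono_degU (h : Consistent m l k) :
    StrictMono fun i : Fin (r + 1) => baseU m i + steps l k i.rev := by
  intro i j hij
  have h1 := h.gap_rev hij
  simp only [baseU]
  omega

theorem strictMono_baseU : StrictMono (baseU m) := by
  intro i j hij
  have h1 : (i : ℕ) < j := hij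
  have h2 := tailSum_anti m (show r - (j : ℕ) ≤ r - i by omega)
  simp only [baseU]
  omega

variable {u : ℂ[X]}

/-- The generators of `U(l, k)`: the blocks of an extremal polynomial. -/
noncomputable def generatorsU (m l : Fin r → ℕ) (k : ℕ) (u : ℂ[X]) (i : Fin (r + 1)) : ℂ[X] :=
  blockPart (baseU m i) (widthU l k i) u

theorem IsExtremal.coeff_generatorsU_ne_zero (hu : IsExtremal (supportU m l k) u)
    (i : Fin (r + 1)) : (generatorsU m l k u i).coeff (baseU m i) ≠ 0 := by
  rw [generatorsU, coeff_blockPart, if_pos ⟨le_rfl, by simp [widthU]⟩]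
  exact hu.coeff_ne_zero (baseU_mem i)

theorem IsExtremal.generatorsU_ne_zero (hu : IsExtremal (supportU m l k) u)
    (i : Fin (r + 1)) : generatorsU m l k u i ≠ 0 := fun h =>
  hu.coeff_generatorsU_ne_zero i (by rw [h, coeff_zero])

theorem IsExtremal.rootMultiplicity_generatorsU (hu : IsExtremal (supportU m l k) u)
    (i : Fin (r + 1)) : (generatorsU m l k u i).rootMultiplicity 0 = baseU m i :=
  rootMultiplicity_zero_eq (X_pow_dvd_blockPart _ _ _) (hu.coeff_generatorsU_ne_zero i)

theorem IsExtremal.linearIndependent_generatorsU (hu : IsExtremal (supportU m l k) u) :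
    LinearIndependent ℂ (generatorsU m l k u) := by
  refine linearIndependent_of_rootMultiplicity 0 hu.generatorsU_ne_zero ?_
  simp only [hu.rootMultiplicity_generatorsU]
  exact strictMono_baseU.injective

theorem IsExtremal.mem_span_generatorsU (hu : IsExtremal (supportU m l k) u)
    (h : Consistent m l k) : u ∈ Submodule.span ℂ (Set.range (generatorsU m l k u)) := by
  have hsum : u = ∑ i, generatorsU m l k u i := eq_sum_blockPart h.disjoint_U hu.coeff_eq_zero
  have hmem : ∑ i, generatorsU m l k u i ∈
      Submodule.span ℂ (Set.range (generatorsU m l k u)) :=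
    Submodule.sum_mem _ fun i _ => Submodule.subset_span ⟨i, rfl⟩
  rwa [← hsum] at hmem

/-- The only exponent at `1` that needs work is the largest, and `u` itself, the sum of the
generators, realises `k + r`. -/
theorem IsExtremal.isSpaceU (hu : IsExtremal (supportU m l k) u) (hr : 1 ≤ r)
    (h : Consistent m l k) :
    IsSpaceU m l k (Submodule.span ℂ (Set.range (generatorsU m l k u))) := by
  have hdeg : degU m l k = fun i => ((baseU m i + steps l k i.rev : ℕ) : ℤ) := funext h.degU_eq
  rw [IsSpaceU, hdeg]
  have hfs : ∀ i : Fin (r + 1), baseU m i = i + firstSum (fun s => m s.rev) i := fun i => by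
    rw [firstSum_rev m (Nat.lt_succ_iff.1 i.2), baseU]
  refine isTwoPointSpace_of_bounds h.strictMono_degU
    (finrank_span_range hu.linearIndependent_generatorsU)
    (fun i => Submodule.subset_span ⟨i, rfl⟩) hu.generatorsU_ne_zero
    (fun i => (hu.rootMultiplicity_generatorsU i).trans (hfs i))
    (fun i => natDegree_blockPart_le _ _ _) ?_ ?_
  · intro β hβ hrange i
    rw [firstSum_last hr]
    split_ifs with hi
    · have hmem : k + r ∈ Set.range β := by
        rw [hrange]
        refine ⟨u, hu.mem_span_generatorsU h, hu.ne_zero, ?_⟩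
        rw [hu.rootMultiplicity_eq h.supportU_nonempty, h.card_supportU]
        rfl
      obtain ⟨j, hj⟩ := hmem
      have := hβ.monotone (Fin.le_last j)
      rw [hi, Fin.val_last]
      omega
    · exact le_of_strictMono hβ i
  · simp only [firstSum_last hr, hfs]
    simp only [Finset.sum_add_distrib, h.sum_steps_rev]
    simp
    omega

theorem IsExtremal.eq_span (hu : IsExtremal (supportU m l k) u) (hr : 1 ≤ r)
    (h : Consistent m l k) {U : Submodule ℂ ℂ[X]} (hU : IsSpaceU m l k U) :
    U = Submodule.span ℂ (Set.range (generatorsU m l k u)) := by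
  have hdim : Module.finrank ℂ U = r + 1 := hU.finrank_eq
  have : FiniteDimensional ℂ U := Module.finite_of_finrank_pos (by omega)
  refine (span_range_eq_of_linearIndependent hdim ?_ hu.linearIndependent_generatorsU).symm
  have hdeg : degU m l k = fun i => ((baseU m i + steps l k i.rev : ℕ) : ℤ) := funext h.degU_eq
  have hzero : exponentsAt U 0 = Set.range (baseU m) := by
    rw [hU.exponents_zero, exponentSet]
    congr 1
    funext i
    rw [firstSum_rev m (Nat.lt_succ_iff.1 i.2), baseU]
  have hinf : degreeSet U = _ := degreeSet_eq_of_exponentsAtInfinity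
    (hU.exponents_infinity.trans (by rw [hdeg]))
  choose f hfU hf0 hfd hfdeg using exists_mem_of_exponents hdim strictMono_baseU
    h.strictMono_degU hzero hinf
  have hfc : ∀ i b, ¬ (baseU m i ≤ b ∧ b < baseU m i + widthU l k i) → (f i).coeff b = 0 := by
    intro i b hb
    by_cases h1 : baseU m i ≤ b
    · refine coeff_eq_zero_of_natDegree_lt (lt_of_le_of_lt (hfdeg i) ?_)
      simp only [widthU] at hb
      omega
    · exact X_pow_dvd_iff.1 (hfd i) b (by omega)
  have hself : ∀ i, blockPart (baseU m i) (widthU l k i) (f i) = f i := by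
    intro i
    ext b
    rw [coeff_blockPart]
    split_ifs with hb
    · rfl
    · exact (hfc i b hb).symm
  have hother : ∀ i j, j ≠ i → blockPart (baseU m i) (widthU l k i) (f j) = 0 := by
    intro i j hij
    ext b
    rw [coeff_blockPart, coeff_zero]
    split_ifs with hb
    · refine hfc j b ?_
      have := h.disjoint_U i j hij.symm
      omega
    · rfl
  have hli : LinearIndependent ℂ f := by
    rw [Fintype.linearIndependent_iff]
    intro g hg i
    have h1 := congrArg (blockPart (baseU m i) (widthU l k i)) hg
    rw [map_sum, Finset.sum_eq_single i (fun j _ hj => by rw [map_smul, hother i j hj, smul_zero])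
      (by simp), map_smul, hself, map_zero] at h1
    exact (smul_eq_zero.1 h1).resolve_right (hf0 i)
  have hspan := span_range_eq_of_linearIndependent hdim hfU hli
  -- An element of `U` of order `k + r` at `1` is a combination of the `f i`, hence supported on the
  -- blocks and extremal. So `u` is a multiple of it, and the blocks of `u` are multiples of the `f
  -- i`.
  have hmem : k + r ∈ exponentsAt U 1 := by
    rw [hU.exponents_one]
    refine ⟨Fin.last r, ?_⟩
    simp only [firstSum_last hr]
    simp
    omega
  obtain ⟨v, hvU, hv0, hvm⟩ := hmem
  rw [← hspan, Submodule.mem_span_range_iff_exists_fun] at hvU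
  obtain ⟨g, hg⟩ := hvU
  have hv : IsExtremal (supportU m l k) v := by
    refine ⟨hv0, ?_, ?_⟩
    · intro b hb
      rw [← hg, finsetSum_coeff]
      refine Finset.sum_eq_zero fun i _ => ?_
      rw [coeff_smul, hfc i b fun h' => hb (mem_blocks.2 ⟨i, h'⟩), smul_zero]
    · rw [← C_1, ← le_rootMultiplicity_iff hv0, hvm, h.card_supportU]
      rfl
  obtain ⟨t, -, rfl⟩ := hu.exists_eq_smul hv h.supportU_nonempty
  intro i
  rw [generatorsU, map_smul, ← hg, map_sum, Finset.sum_eq_single i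
    (fun j _ hj => by rw [map_smul, hother i j hj, smul_zero]) (by simp), map_smul, hself]
  exact U.smul_mem _ (U.smul_mem _ (hfU i))

end U

/-! ### Counting the steps of a path -/

section Path

variable {r : ℕ}

/-- The number of occurrences of `i` in the sequence `j`. -/
def count {k : ℕ} (j : Fin k → Fin (r + 1)) (i : Fin (r + 1)) : ℕ :=
  ∑ s, if j s = i then 1 else 0

theorem count_succ {k : ℕ} (j : Fin (k + 1) → Fin (r + 1)) (i : Fin (r + 1)) :
    count j i = count (fun s : Fin k => j s.castSucc) i + if j (Fin.last k) = i then 1 else 0 :=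
  Fin.sum_univ_castSucc _

/-- The entry `l_i` of the end point counts the steps with index at least `i`, including `l_0 = k`;
successive differences then count the steps equal to `i`. -/
theorem ext_sum_ones {k : ℕ} (j : Fin k → Fin (r + 1)) (i : ℕ) :
    ext (∑ s, ones (j s)) k i = ∑ s, if i ≤ (j s : ℕ) then 1 else 0 := by
  obtain _ | i := i
  · simp [ext]
  · by_cases hi : i < r
    · rw [ext, dif_pos hi, Finset.sum_apply]
      simp only [ones, Nat.lt_iff_add_one_le]
    · rw [ext_of_lt _ _ (by omega), eq_comm]
      refine Finset.sum_eq_zero fun s _ => if_neg ?_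
      have := (j s).2
      omega

theorem ext_sum_ones_eq {k : ℕ} (j : Fin k → Fin (r + 1)) (i : Fin (r + 1)) :
    ext (∑ s, ones (j s)) k i = ext (∑ s, ones (j s)) k (i + 1) + count j i := by
  rw [ext_sum_ones, ext_sum_ones, count, ← Finset.sum_add_distrib]
  refine Finset.sum_congr rfl fun s _ => ?_
  by_cases h : j s = i
  · simp [h]
  · have : (j s : ℕ) ≠ i := fun h' => h (Fin.ext h')
    rw [if_neg h]
    split_ifs <;> omega

theorem steps_sum_ones {k : ℕ} (j : Fin k → Fin (r + 1)) :
    steps (∑ s, ones (j s)) k = count j := by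
  funext i
  have := ext_sum_ones_eq j i
  rw [steps]
  omega

variable {m l : Fin r → ℕ} {k : ℕ}

theorem Consistent.eq_of_steps_eq {l' : Fin r → ℕ} (h : Consistent m l k)
    (h' : ∀ i : Fin (r + 1), ext l' k i = ext l' k (i + 1) + steps l k i) : l' = l := by
  have key : ∀ n, n ≤ r + 1 → ext l' k (r + 1 - n) = ext l k (r + 1 - n) := by
    intro n
    induction n with
    | zero => intro _; rw [ext_of_lt _ _ (by omega), ext_of_lt _ _ (by omega)]
    | succ n ih =>
      intro hn
      have h1 := h' ⟨r + 1 - (n + 1), by omega⟩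
      have h2 := h.ext_eq ⟨r + 1 - (n + 1), by omega⟩
      have h3 := ih (by omega)
      simp only at h1 h2
      rw [show r + 1 - (n + 1) + 1 = r + 1 - n by omega] at h1 h2
      omega
  funext s
  have h1 := key (r - s) (by omega)
  rw [show r + 1 - (r - (s : ℕ)) = s + 1 by omega] at h1
  simpa [ext] using h1

/-- Any sequence in which each `i` occurs `steps l k i` times will do, whatever its order. -/
theorem Consistent.exists_path (h : Consistent m l k) :
    ∃ j : Fin k → Fin (r + 1), ∑ s, ones (j s) = l := by
  have e : Fin k ≃ (Σ i : Fin (r + 1), Fin (steps l k i)) := Fintype.equivOfCardEq (by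
    rw [Fintype.card_sigma]
    simp [h.sum_steps])
  refine ⟨fun s => (e s).1, h.eq_of_steps_eq fun i => ?_⟩
  rw [ext_sum_ones_eq]
  congr 1
  rw [count, Equiv.sum_comp e (fun x => if x.1 = i then 1 else 0), Fintype.sum_sigma,
    Finset.sum_eq_single i (fun b _ hb => by simp [hb]) (by simp)]
  simp

end Path

/-! ### Products of shifted Euler operators -/

/-- The Euler operator `x d/dx`. -/
noncomputable def euler : Module.End ℂ ℂ[X] := LinearMap.mulLeft ℂ X * derivative

theorem euler_apply (f : ℂ[X]) : euler f = X * derivative f := rfl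

/-- The polynomial `∏_i ∏_{s < c_i} (X - φ i s)`. -/
noncomputable def nodePoly {r : ℕ} (φ : Fin (r + 1) → ℕ → ℂ) (c : Fin (r + 1) → ℕ) : ℂ[X] :=
  ∏ i, ∏ s ∈ Finset.range (c i), (X - C (φ i s))

theorem nodePoly_count_zero {r : ℕ} (φ : Fin (r + 1) → ℕ → ℂ) (j : Fin 0 → Fin (r + 1)) :
    nodePoly φ (count j) = 1 := by
  simp [nodePoly, count]

/-- Appending a step `i` uses up the next node of `i`, so the accumulated product records only the
counts. -/
theorem nodePoly_count_succ {r k : ℕ} (φ : Fin (r + 1) → ℕ → ℂ) (j : Fin (k + 1) → Fin (r + 1)) :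
    nodePoly φ (count j) =
      (X - C (φ (j (Fin.last k)) (count (fun s : Fin k => j s.castSucc) (j (Fin.last k))))) *
        nodePoly φ (count fun s : Fin k => j s.castSucc) := by
  set c := count fun s : Fin k => j s.castSucc with hc
  have h1 : ∀ i, ∏ s ∈ Finset.range (count j i), (X - C (φ i s)) =
      (if j (Fin.last k) = i then X - C (φ i (c i)) else 1) *
        ∏ s ∈ Finset.range (c i), (X - C (φ i s)) := by
    intro i
    rw [count_succ, ← hc]
    split_ifs with h
    · rw [Finset.prod_range_succ, mul_comm]
    · rw [add_zero, one_mul]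
  rw [nodePoly, Finset.prod_congr rfl fun i _ => h1 i, Finset.prod_mul_distrib,
    Finset.prod_ite_eq Finset.univ (j (Fin.last k)) fun i => X - C (φ i (c i)),
    if_pos (Finset.mem_univ _), nodePoly]

theorem eval_nodePoly {r : ℕ} (φ : Fin (r + 1) → ℕ → ℂ) (c : Fin (r + 1) → ℕ) (x : ℂ) :
    (nodePoly φ c).eval x = ∏ i, ∏ s ∈ Finset.range (c i), (x - φ i s) := by
  simp [nodePoly, eval_prod]

theorem eval_nodePoly_ne_zero {r : ℕ} {φ : Fin (r + 1) → ℕ → ℂ} {c : Fin (r + 1) → ℕ} {x : ℂ}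
    (h : ∀ i s, s < c i → x ≠ φ i s) : (nodePoly φ c).eval x ≠ 0 := by
  rw [eval_nodePoly]
  refine Finset.prod_ne_zero_iff.2 fun i _ => Finset.prod_ne_zero_iff.2 fun s hs => ?_
  exact sub_ne_zero.2 (h i s (Finset.mem_range.1 hs))

theorem eval_nodePoly_eq_zero {r : ℕ} {φ : Fin (r + 1) → ℕ → ℂ} {c : Fin (r + 1) → ℕ} {x : ℂ}
    {i : Fin (r + 1)} {s : ℕ} (hs : s < c i) (h : x = φ i s) : (nodePoly φ c).eval x = 0 := by
  rw [eval_nodePoly]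
  refine Finset.prod_eq_zero (Finset.mem_univ i) (Finset.prod_eq_zero (Finset.mem_range.2 hs) ?_)
  rw [h, sub_self]

theorem aeval_euler_mul (α : ℂ) (p f : ℂ[X]) :
    aeval euler ((X - C α) * p) f =
      X * derivative (aeval euler p f) - C α * aeval euler p f := by
  rw [map_mul, Module.End.mul_apply, map_sub, aeval_X, aeval_C, LinearMap.sub_apply, euler_apply,
    Module.algebraMap_end_apply, smul_eq_C_mul]

theorem aeval_euler_monomial (p : ℂ[X]) (b : ℕ) (t : ℂ) :
    aeval euler p (monomial b t) = p.eval (b : ℂ) • monomial b t := by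
  have h1 : euler (monomial b t) = (b : ℂ) • monomial b t := by
    rw [euler_apply, derivative_monomial, X_mul_monomial, smul_monomial]
    rcases b with _ | b
    · simp
    · simp [mul_comm]
  by_cases ht : monomial b t = 0
  · rw [ht, map_zero, smul_zero]
  · exact Module.End.aeval_apply_of_hasEigenvector
      ⟨Module.End.mem_eigenspace_iff.2 h1, ht⟩

/-! ### The operators of `V` -/

section OperatorsV

variable {r : ℕ} (m : Fin r → ℕ)

/-- The nodes of the operators of `V`. -/
noncomputable def nodeV (i : Fin (r + 1)) (s : ℕ) : ℂ :=
  (((i : ℕ) + firstSum m i : ℕ) : ℂ) - s - 1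

theorem compV_succ_apply {k : ℕ} (j : Fin (k + 1) → Fin (r + 1)) (f : ℂ[X]) :
    compV m (k + 1) j f =
      X * (X - 1) * derivative (compV m k (fun s => j s.castSucc) f)
      - C (nodeV m (j (Fin.last k)) (count (fun s : Fin k => j s.castSucc) (j (Fin.last k)))
          + k + 1) * (X - 1) * compV m k (fun s => j s.castSucc) f
      - C ((k : ℂ) + 1) * compV m k (fun s => j s.castSucc) f := by
  rw [compV, Module.End.mul_apply, opV, ext_sum_ones_eq, nodeV]
  simp only [LinearMap.sub_apply, Module.End.mul_apply, LinearMap.mulLeft_apply,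
    LinearMap.smul_apply, Module.End.one_apply, smul_eq_C_mul]
  congr 4
  push_cast
  ring_nf

/-- With `e = α + k + 1`, differentiating `(X - 1)^(k + 1)` contributes the factor `(k + 1) X - e (X
- 1) - (k + 1) = -α (X - 1)`. Each step thus yields one more power of `X - 1` and a factor `θ - α`.
-/
theorem compV_X_sub_one_mul {k : ℕ} (j : Fin k → Fin (r + 1)) (f : ℂ[X]) :
    compV m k j ((X - 1) * f) =
      (X - 1) ^ (k + 1) * aeval euler (nodePoly (nodeV m) (count j)) f := by
  induction k with
  | zero => rw [nodePoly_count_zero, compV]; simp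
  | succ k ih =>
    rw [compV_succ_apply, ih, nodePoly_count_succ, aeval_euler_mul]
    generalize aeval euler (nodePoly (nodeV m) (count fun s : Fin k => j s.castSucc)) f = g
    generalize nodeV m (j (Fin.last k)) _ = α
    rw [derivative_mul, ← C_1, derivative_X_sub_C_pow]
    simp only [C_add, C_1, map_natCast, Nat.cast_add, Nat.cast_one, Nat.add_sub_cancel]
    ring

/-- At `0` a step multiplies the coefficient of `X ^ a` by `-(a - α)`, with `α` the node of that
step. -/
theorem compV_X_pow {k : ℕ} (j : Fin k → Fin (r + 1)) (a : ℕ) :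
    ∃ p : ℂ[X], compV m k j (X ^ a) = X ^ a * p ∧
      p.coeff 0 = (-1) ^ k * (nodePoly (nodeV m) (count j)).eval (a : ℂ) := by
  induction k with
  | zero => exact ⟨1, by rw [nodePoly_count_zero, compV]; simp⟩
  | succ k ih =>
    obtain ⟨p, hp, hp0⟩ := ih fun s => j s.castSucc
    rw [compV_succ_apply, hp, nodePoly_count_succ]
    generalize nodeV m (j (Fin.last k)) _ = α
    refine ⟨(X - 1) * (C (a : ℂ) * p + X * derivative p) - C (α + k + 1) * (X - 1) * p
      - C ((k : ℂ) + 1) * p, ?_, ?_⟩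
    · rcases a with _ | a
      · simp
        ring
      · rw [derivative_mul, derivative_X_pow, Nat.add_sub_cancel]
        simp only [map_natCast]
        ring
    · rw [coeff_zero_eq_eval_zero] at hp0 ⊢
      simp only [eval_sub, eval_add, eval_mul, eval_X, eval_C, eval_one, hp0]
      ring

theorem pow_dvd_compV_X_pow_sub {k : ℕ} (j : Fin k → Fin (r + 1)) (a b : ℕ) :
    (X - 1) ^ (k + 1) ∣ compV m k j (X ^ a) - compV m k j (X ^ b) := by
  obtain ⟨g, hg⟩ : (X - 1 : ℂ[X]) ∣ X ^ a - X ^ b := X_sub_one_dvd (by simp)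
  rw [← map_sub, hg, compV_X_sub_one_mul]
  exact dvd_mul_right _ _

theorem eval_one_compV {k : ℕ} (j : Fin k → Fin (r + 1)) {f : ℂ[X]} (hf : f.eval 1 ≠ 0) :
    (compV m k j f).eval 1 ≠ 0 := by
  induction k with
  | zero => simpa [compV] using hf
  | succ k ih =>
    rw [compV_succ_apply]
    have h1 := ih fun s => j s.castSucc
    have h2 : (k : ℂ) + 1 ≠ 0 := Nat.cast_add_one_ne_zero k
    simp [h1, h2]

/-- The coefficient of `X ^ (d + 1)` is `d - e` times that of `X ^ d` in `f`, which vanishes for `e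
= d`. -/
theorem natDegree_compV_step_le {f : ℂ[X]} {d k : ℕ} {e : ℂ} (hf : f.natDegree ≤ d) :
    (X * (X - 1) * derivative f - C e * (X - 1) * f - C ((k : ℂ) + 1) * f).natDegree ≤ d + 1 ∧
    (e = d → (X * (X - 1) * derivative f - C e * (X - 1) * f
      - C ((k : ℂ) + 1) * f).natDegree ≤ d) := by
  have hcoeff : ∀ n, (X * (X - 1) * derivative f - C e * (X - 1) * f
      - C ((k : ℂ) + 1) * f).coeff (n + 1) =
      (n - e) * f.coeff n + (e - (n + 1) - (k + 1)) * f.coeff (n + 1) := by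
    intro n
    have hre : X * (X - 1) * derivative f - C e * (X - 1) * f - C ((k : ℂ) + 1) * f =
        X * (X * derivative f) - X * derivative f - C e * (X * f) + C e * f
          - C ((k : ℂ) + 1) * f := by ring
    rw [hre]
    simp only [coeff_sub, coeff_add, coeff_C_mul, coeff_X_mul, coeff_derivative]
    have : (X * derivative f).coeff n = n * f.coeff n := by
      rcases n with _ | n
      · simp
      · rw [coeff_X_mul, coeff_derivative]
        push_cast
        ring
    rw [this]
    ring
  constructor
  · rw [natDegree_le_iff_coeff_eq_zero]
    intro n hn
    obtain ⟨n, rfl⟩ := Nat.exists_eq_add_of_lt (lt_of_le_of_lt (Nat.zero_le _) hn)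
    rw [zero_add] at hn ⊢
    rw [hcoeff, coeff_eq_zero_of_natDegree_lt (n := n) (by omega),
      coeff_eq_zero_of_natDegree_lt (n := n + 1) (by omega)]
    simp
  · rintro rfl
    rw [natDegree_le_iff_coeff_eq_zero]
    intro n hn
    obtain ⟨n, rfl⟩ := Nat.exists_eq_add_of_lt (lt_of_le_of_lt (Nat.zero_le _) hn)
    rw [zero_add] at hn ⊢
    rw [hcoeff, coeff_eq_zero_of_natDegree_lt (n := n + 1) (by omega), mul_zero, add_zero]
    by_cases hnd : n = d
    · rw [hnd, sub_self, zero_mul]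
    · rw [coeff_eq_zero_of_natDegree_lt (n := n) (by omega), mul_zero]

theorem count_le {k : ℕ} (j : Fin k → Fin (r + 1)) (i : Fin (r + 1)) : count j i ≤ k := by
  refine (Finset.sum_le_card_nsmul _ _ 1 fun s _ => ?_).trans (by simp)
  split_ifs <;> simp

theorem natDegree_compV_le {k : ℕ} (j : Fin k → Fin (r + 1)) (i : Fin (r + 1)) :
    (compV m k j (X ^ ((i : ℕ) + firstSum m i))).natDegree ≤
      i + firstSum m i + (k - count j i) := by
  induction k with
  | zero => simp [compV]
  | succ k ih =>
    rw [compV_succ_apply, count_succ]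
    obtain ⟨h1, h2⟩ := natDegree_compV_step_le (k := k)
      (e := nodeV m (j (Fin.last k)) (count (fun s : Fin k => j s.castSucc) (j (Fin.last k)))
          + k + 1) (ih fun s => j s.castSucc)
    have h3 := count_le (fun s : Fin k => j s.castSucc) i
    split_ifs with h
    · rw [show k + 1 - (count (fun s : Fin k => j s.castSucc) i + 1) =
        k - count (fun s : Fin k => j s.castSucc) i by omega]
      -- For a step `i` the constant `e` is `a_i + k - count`, precisely the current degree bound.
      refine h2 ?_
      rw [h, nodeV, Nat.cast_add _ (k - _), Nat.cast_sub h3]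
      ring
    · refine h1.trans ?_
      omega

/-- The difference `E` of the two operators kills all multiples of `X - 1`. Hence `E 1 = E (X ^ a)`
is divisible by `X ^ a` for every `a`, which forces `E 1 = 0`. -/
theorem compV_eq_of_count_eq {k : ℕ} {j j' : Fin k → Fin (r + 1)} (h : count j = count j') :
    compV m k j = compV m k j' := by
  set E := compV m k j - compV m k j' with hE
  have h1 : ∀ f, E ((X - 1) * f) = 0 := fun f => by
    rw [hE, LinearMap.sub_apply, compV_X_sub_one_mul, compV_X_sub_one_mul, h, sub_self]
  have h2 : ∀ f : ℂ[X], f.eval 1 = 0 → E f = 0 := by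
    intro f hf
    obtain ⟨g, rfl⟩ := X_sub_one_dvd hf
    exact h1 g
  have h3 : ∀ a, X ^ a ∣ E 1 := by
    intro a
    have h4 := h2 (1 - X ^ a) (by simp)
    rw [map_sub, sub_eq_zero] at h4
    obtain ⟨p, hp, -⟩ := compV_X_pow m j a
    obtain ⟨q, hq, -⟩ := compV_X_pow m j' a
    rw [h4, hE, LinearMap.sub_apply, hp, hq, ← mul_sub]
    exact dvd_mul_right _ _
  have h4 : E 1 = 0 := by
    by_contra hne
    have := natDegree_le_of_dvd (h3 ((E 1).natDegree + 1)) hne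
    rw [natDegree_X_pow] at this
    omega
  rw [← sub_eq_zero]
  change E = 0
  refine LinearMap.ext fun f => ?_
  have h5 := h2 (f - f.eval 1 • 1) (by simp)
  rwa [map_sub, map_smul, h4, smul_zero, sub_zero] at h5

variable {m}

theorem Consistent.isGeneratorsV {k : ℕ} {j : Fin k → Fin (r + 1)}
    (h : Consistent m (∑ s, ones (j s)) k) :
    IsGeneratorsV m (∑ s, ones (j s)) k
      fun i : Fin (r + 1) => compV m k j (X ^ ((i : ℕ) + firstSum m i)) := by
  refine ⟨fun i => ?_, fun i => ?_, fun i => ?_, fun i i' => pow_dvd_compV_X_pow_sub m j _ _,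
    fun i => eval_one_compV m j (by simp)⟩
  · obtain ⟨p, hp, -⟩ := compV_X_pow m j ((i : ℕ) + firstSum m i)
    exact ⟨p, hp⟩
  · obtain ⟨p, hp, hp0⟩ := compV_X_pow m j ((i : ℕ) + firstSum m i)
    have hc : (X ^ ((i : ℕ) + firstSum m i) * p).coeff (i + firstSum m i) = p.coeff 0 := by
      simpa using coeff_X_pow_mul p ((i : ℕ) + firstSum m i) 0
    rw [hp, hc, hp0]
    refine mul_ne_zero (pow_ne_zero _ (by simp)) (eval_nodePoly_ne_zero fun i' s hs heq => ?_)
    rw [← steps_sum_ones] at hs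
    rw [nodeV, eq_sub_iff_add_eq, eq_sub_iff_add_eq] at heq
    have h1 : (i : ℕ) + firstSum m i + 1 + s = i' + firstSum m i' := by exact_mod_cast heq
    -- A node `a_{i'} - s - 1` with `s < c_{i'}` lies strictly between `a_i` and `a_{i'}` when `i <
    -- i'`, by the gap; otherwise it is less than `a_{i'} ≤ a_i`.
    rcases lt_or_ge i i' with h2 | h2
    · have := h.gap h2
      omega
    · have h3 : (i' : ℕ) + firstSum m i' ≤ i + firstSum m i :=
        (strictMono_add_firstSum m).monotone h2
      omega
  · rw [steps_sum_ones]
    exact natDegree_compV_le m j i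

end OperatorsV

/-! ### The operators of `U` -/

section OperatorsU

variable {r : ℕ} (m : Fin r → ℕ)

/-- The nodes of the operators of `U`. -/
noncomputable def nodeU (i : Fin (r + 1)) (s : ℕ) : ℂ := (baseU m i.rev : ℂ) + s + 1

/-- The parameters of each factor of `compU` include the step itself, whence the `+ 1` in `nodeU`.
All factors are polynomials in `θ` and commute, so their order is immaterial. -/
theorem compU_eq_aeval {k : ℕ} (j : Fin k → Fin (r + 1)) :
    compU m k j = aeval euler (nodePoly (nodeU m) (count j)) := by
  induction k with
  | zero => rw [nodePoly_count_zero, compU, map_one]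
  | succ k ih =>
    have hop : opU m (∑ s, ones (j s)) (k + 1) (j (Fin.last k)) = aeval euler (X - C (nodeU m
        (j (Fin.last k)) (count (fun s : Fin k => j s.castSucc) (j (Fin.last k))))) := by
      rw [map_sub, aeval_X, aeval_C, opU, ext_sum_ones_eq, count_succ, if_pos rfl, nodeU, baseU,
        ← euler, Algebra.algebraMap_eq_smul_one]
      have hle : (j (Fin.last k) : ℕ) ≤ r := Nat.lt_succ_iff.1 (j (Fin.last k)).2
      have hrev : ((j (Fin.last k)).rev : ℕ) = r - j (Fin.last k) := by rw [Fin.val_rev]; omega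
      rw [hrev, Nat.sub_sub_self hle]
      congr 2
      push_cast [Nat.cast_sub hle]
      ring
    rw [nodePoly_count_succ, map_mul, ← hop, compU, ih, hop, ← map_mul, ← map_mul, mul_comm]

variable {m}

/-- The nodes attached to `i.rev` are exactly the exponents of the `i`-th block above its lowest
one. That lowest exponent is not a node, by the gaps. -/
theorem compU_generatorsU {k : ℕ} {j : Fin k → Fin (r + 1)} {u : ℂ[X]}
    (h : Consistent m (∑ s, ones (j s)) k) (hu : IsExtremal (supportU m (∑ s, ones (j s)) k) u)
    (i : Fin (r + 1)) :
    ∃ t : ℂ, t ≠ 0 ∧ compU m k j (generatorsU m (∑ s, ones (j s)) k u i) = t • X ^ baseU m i := by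
  refine ⟨(nodePoly (nodeU m) (count j)).eval (baseU m i : ℂ) * u.coeff (baseU m i),
    mul_ne_zero (eval_nodePoly_ne_zero fun i' s hs heq => ?_) (hu.coeff_ne_zero (baseU_mem i)), ?_⟩
  · rw [← steps_sum_ones] at hs
    have h1 : baseU m i = baseU m i'.rev + s + 1 := by rw [nodeU] at heq; exact_mod_cast heq
    rcases lt_or_ge i'.rev i with h2 | h2
    · have := h.gap_rev h2
      rw [Fin.rev_rev] at this
      simp only [baseU] at h1
      omega
    · have := (strictMono_baseU (m := m)).monotone h2
      omega
  · rw [generatorsU, blockPart_apply, map_sum, Finset.sum_eq_single (baseU m i)]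
    · rw [compU_eq_aeval, aeval_euler_monomial, ← smul_X_eq_monomial, smul_smul]
    · intro b hb hne
      rw [Finset.mem_Ico, widthU, steps_sum_ones] at hb
      rw [compU_eq_aeval, aeval_euler_monomial,
        eval_nodePoly_eq_zero (i := i.rev) (s := b - baseU m i - 1) (by omega), zero_smul]
      obtain ⟨e, rfl⟩ := Nat.exists_eq_add_of_lt (lt_of_le_of_ne hb.1 hne.symm)
      rw [nodeU, Fin.rev_rev, show baseU m i + e + 1 - baseU m i - 1 = e by omega]
      push_cast
      ring
    · intro hn
      exact absurd (Finset.mem_Ico.2 ⟨le_rfl, by simp [widthU]⟩) hn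

end OperatorsU

/-! ### Orders of differential operators -/

theorem IsDiffOpOfOrder.mul_left {k : ℕ} {D P : Module.End ℂ ℂ[X]} (hD : IsDiffOpOfOrder k D)
    {p : ℂ[X]} (hp : p ≠ 0) (hP : ∀ f, P f = p * derivative f + P 1 * f) :
    IsDiffOpOfOrder (k + 1) (P * D) := by
  obtain ⟨a, ha, hDa⟩ := hD
  set q := P 1
  -- The coefficients `a i` with `i > k` are arbitrary; cutting them off makes the new leading
  -- coefficient `p * a k`.
  let a' : ℕ → ℂ[X] := fun i => if i ≤ k then a i else 0
  refine ⟨fun i => p * derivative (a' i) + q * a' i + p * (if i = 0 then 0 else a' (i - 1)),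
    ?_, fun f => ?_⟩
  · simp [a', hp, ha]
  · have h1 : ∑ i ∈ Finset.range (k + 1 + 1), (p * derivative (a' i) + q * a' i) *
        derivative^[i] f = ∑ i ∈ Finset.range (k + 1), (p * derivative (a i) + q * a i) *
        derivative^[i] f := by
      rw [Finset.sum_range_succ]
      simp only [a', if_neg (show ¬ k + 1 ≤ k by omega), derivative_zero, mul_zero, add_zero,
        zero_mul]
      refine Finset.sum_congr rfl fun i hi => ?_
      rw [if_pos (Nat.lt_succ_iff.1 (Finset.mem_range.1 hi))]
    have h2 : ∑ i ∈ Finset.range (k + 1 + 1), p * (if i = 0 then 0 else a' (i - 1)) *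
        derivative^[i] f = ∑ i ∈ Finset.range (k + 1), p * a i * derivative^[i + 1] f := by
      rw [Finset.sum_range_succ']
      simp only [if_pos, mul_zero, zero_mul, add_zero, Nat.succ_ne_zero, if_false,
        Nat.add_sub_cancel]
      refine Finset.sum_congr rfl fun i hi => ?_
      simp only [a', if_pos (Nat.lt_succ_iff.1 (Finset.mem_range.1 hi))]
    simp only [add_mul _ (p * ite _ _ _)]
    rw [Finset.sum_add_distrib, h1, h2, ← Finset.sum_add_distrib, Module.End.mul_apply, hP, hDa,
      derivative_sum, Finset.mul_sum, Finset.mul_sum, ← Finset.sum_add_distrib]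
    refine Finset.sum_congr rfl fun i _ => ?_
    rw [derivative_mul, Function.iterate_succ_apply']
    ring

theorem isDiffOpOfOrder_one : IsDiffOpOfOrder 0 1 := ⟨fun _ => 1, one_ne_zero, by simp⟩

theorem isDiffOpOfOrder_compV {r : ℕ} (m : Fin r → ℕ) {k : ℕ} (j : Fin k → Fin (r + 1)) :
    IsDiffOpOfOrder k (compV m k j) := by
  induction k with
  | zero => exact isDiffOpOfOrder_one
  | succ k ih =>
    rw [compV]
    refine (ih fun s => j s.castSucc).mul_left (p := X * (X - 1))
      (mul_ne_zero X_ne_zero (by simpa using X_sub_C_ne_zero (1 : ℂ))) fun f => ?_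
    simp only [opV, LinearMap.sub_apply, Module.End.mul_apply, LinearMap.mulLeft_apply,
      LinearMap.smul_apply, Module.End.one_apply, smul_eq_C_mul, derivative_one]
    ring

theorem isDiffOpOfOrder_compU {r : ℕ} (m : Fin r → ℕ) {k : ℕ} (j : Fin k → Fin (r + 1)) :
    IsDiffOpOfOrder k (compU m k j) := by
  induction k with
  | zero => exact isDiffOpOfOrder_one
  | succ k ih =>
    rw [compU_eq_aeval, nodePoly_count_succ, map_mul, ← compU_eq_aeval]
    refine (ih fun s => j s.castSucc).mul_left (p := X) X_ne_zero fun f => ?_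
    simp only [map_sub, aeval_X, aeval_C, LinearMap.sub_apply, euler_apply,
      Module.algebraMap_end_apply, smul_eq_C_mul, derivative_one]
    ring

/-! ### The main theorem -/

section Main

variable {r : ℕ} {m l : Fin r → ℕ} {k : ℕ}

theorem spaceV_eq {V : Submodule ℂ ℂ[X]} (hV : IsSpaceV m l k V)
    (huniq : ∀ V', IsSpaceV m l k V' → V' = V) : spaceV m l k = V := by
  have hex : ∃ V, IsSpaceV m l k V := ⟨V, hV⟩
  rw [spaceV, dif_pos hex]
  exact huniq _ hex.choose_spec

theorem spaceU_eq {U : Submodule ℂ ℂ[X]} (hU : IsSpaceU m l k U)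
    (huniq : ∀ U', IsSpaceU m l k U' → U' = U) : spaceU m l k = U := by
  have hex : ∃ U, IsSpaceU m l k U := ⟨U, hU⟩
  rw [spaceU, dif_pos hex]
  exact huniq _ hex.choose_spec

theorem consistent_zero (m : Fin r → ℕ) : Consistent m 0 0 := by
  have h : ∀ i, ext (0 : Fin r → ℕ) 0 i = 0 := by
    intro i
    rcases i with _ | i
    · rfl
    · simp [ext]
  refine ⟨fun i _ => by simp [h], fun s => ?_⟩
  rw [h, h]
  simp

/-- Two paths with the same end point have the same numbers of steps. -/
theorem count_eq_of_sum_ones_eq {j j' : Fin k → Fin (r + 1)}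
    (h : ∑ s, ones (j s) = ∑ s, ones (j' s)) : count j = count j' := by
  rw [← steps_sum_ones, ← steps_sum_ones, h]

theorem spaceV_eq_span {j : Fin k → Fin (r + 1)} (h : Consistent m (∑ s, ones (j s)) k) :
    spaceV m (∑ s, ones (j s)) k = Submodule.span ℂ (Set.range fun i : Fin (r + 1) =>
      compV m k j (X ^ ((i : ℕ) + firstSum m i))) :=
  spaceV_eq (h.isGeneratorsV.isSpaceV h) fun _ => h.isGeneratorsV.eq_span h

theorem spaceV_zero (m : Fin r → ℕ) : spaceV m 0 0 =
    Submodule.span ℂ (Set.range fun i : Fin (r + 1) => (X : ℂ[X]) ^ ((i : ℕ) + firstSum m i)) := by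
  have h0 : ∑ s, ones ((Fin.elim0 : Fin 0 → Fin (r + 1)) s) = 0 := by simp
  have := spaceV_eq_span (m := m) (j := (Fin.elim0 : Fin 0 → Fin (r + 1)))
    (h0 ▸ consistent_zero m)
  rwa [h0] at this

theorem spaceU_eq_span (hr : 1 ≤ r) (h : Consistent m l k) {u : ℂ[X]}
    (hu : IsExtremal (supportU m l k) u) :
    spaceU m l k = Submodule.span ℂ (Set.range (generatorsU m l k u)) :=
  spaceU_eq (hu.isSpaceU hr h) fun _ => hu.eq_span hr h

/-- Rescaling a finite family does not change its span. -/
theorem span_range_eq_of_smul {n : ℕ} {f g : Fin n → ℂ[X]}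
    (h : ∀ i, ∃ t : ℂ, t ≠ 0 ∧ f i = t • g i) :
    Submodule.span ℂ (Set.range f) = Submodule.span ℂ (Set.range g) := by
  refine le_antisymm ?_ ?_ <;> rw [Submodule.span_le] <;> rintro _ ⟨i, rfl⟩ <;>
    obtain ⟨t, ht, hi⟩ := h i
  · rw [hi]
    exact Submodule.smul_mem _ _ (Submodule.subset_span ⟨i, rfl⟩)
  · rw [← inv_smul_smul₀ ht (g i), ← hi]
    exact Submodule.smul_mem _ _ (Submodule.subset_span ⟨i, rfl⟩)

theorem map_spaceU (hr : 1 ≤ r) {j : Fin k → Fin (r + 1)}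
    (h : Consistent m (∑ s, ones (j s)) k) :
    (spaceU m (∑ s, ones (j s)) k).map (compU m k j) =
      Submodule.span ℂ (Set.range fun i : Fin (r + 1) => (X : ℂ[X]) ^ baseU m i) := by
  obtain ⟨u, hu⟩ := exists_isExtremal h.supportU_nonempty
  rw [spaceU_eq_span hr h hu, Submodule.map_span, ← Set.range_comp]
  exact span_range_eq_of_smul (compU_generatorsU h hu)

theorem spaceU_zero (hr : 1 ≤ r) (m : Fin r → ℕ) : spaceU m 0 0 =
    Submodule.span ℂ (Set.range fun i : Fin (r + 1) => (X : ℂ[X]) ^ baseU m i) := by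
  have h0 : ∑ s, ones ((Fin.elim0 : Fin 0 → Fin (r + 1)) s) = 0 := by simp
  have := map_spaceU hr (m := m) (j := (Fin.elim0 : Fin 0 → Fin (r + 1)))
    (h0 ▸ consistent_zero m)
  rwa [h0, compU, Module.End.one_eq_id, Submodule.map_id] at this

end Main

end TwoPointSpaces

theorem mainTheorem7 {r : ℕ} (hr : 1 ≤ r) (m l : Fin r → ℕ) (k : ℕ)
    (h : TwoPointSpaces.Consistent m l k) :
    ((∃! V : Submodule ℂ ℂ[X], TwoPointSpaces.IsSpaceV m l k V) ∧
      TwoPointSpaces.spaceV m 0 0 =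
        Submodule.span ℂ (Set.range fun i : Fin (r + 1) =>
          (X : ℂ[X]) ^ ((i : ℕ) + TwoPointSpaces.firstSum m i)) ∧
      ∃! D : Module.End ℂ ℂ[X],
        TwoPointSpaces.IsDiffOpOfOrder k D ∧
        (∃ j : Fin k → Fin (r + 1),
          ∑ s, TwoPointSpaces.ones (j s) = l ∧ D = TwoPointSpaces.compV m k j) ∧
        TwoPointSpaces.spaceV m l k = (TwoPointSpaces.spaceV m 0 0).map D) ∧
    ((∃! U : Submodule ℂ ℂ[X], TwoPointSpaces.IsSpaceU m l k U) ∧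
      TwoPointSpaces.spaceU m 0 0 =
        Submodule.span ℂ (Set.range fun i : Fin (r + 1) =>
          (X : ℂ[X]) ^ ((i : ℕ) + TwoPointSpaces.tailSum m (r - i))) ∧
      ∃! D : Module.End ℂ ℂ[X],
        TwoPointSpaces.IsDiffOpOfOrder k D ∧
        (∃ j : Fin k → Fin (r + 1),
          ∑ s, TwoPointSpaces.ones (j s) = l ∧ D = TwoPointSpaces.compU m k j) ∧
        TwoPointSpaces.spaceU m 0 0 = (TwoPointSpaces.spaceU m l k).map D) := by
  open TwoPointSpaces in
  -- From here `l` is the end point of a chosen path, whose operator serves as the witness in both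
  -- parts.
  obtain ⟨j, rfl⟩ := h.exists_path
  obtain ⟨u, hu⟩ := exists_isExtremal h.supportU_nonempty
  refine ⟨⟨⟨_, h.isGeneratorsV.isSpaceV h, fun _ => h.isGeneratorsV.eq_span h⟩, spaceV_zero m,
    compV m k j, ⟨isDiffOpOfOrder_compV m j, ⟨j, rfl, rfl⟩, ?_⟩, ?_⟩,
    ⟨_, hu.isSpaceU hr h, fun _ => hu.eq_span hr h⟩, spaceU_zero hr m,
    compU m k j, ⟨isDiffOpOfOrder_compU m j, ⟨j, rfl, rfl⟩, ?_⟩, ?_⟩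
  · rw [spaceV_eq_span h, spaceV_zero, Submodule.map_span, ← Set.range_comp]
    rfl
  -- Another path to the same end point has the same counts, so uniqueness needs neither the order
  -- of the operator nor its action on the space.
  · rintro _ ⟨-, ⟨j', hj', rfl⟩, -⟩
    exact compV_eq_of_count_eq m (count_eq_of_sum_ones_eq hj')
  · rw [spaceU_zero hr, map_spaceU hr h]
  · rintro _ ⟨-, ⟨j', hj', rfl⟩, -⟩
    rw [compU_eq_aeval, compU_eq_aeval, count_eq_of_sum_ones_eq hj']
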